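/- Let $V$ be a finite-dimensional complex vector space, $\rho\colon \mathbb Z^2\to \mathrm{SL}(V)$ a representation, $\Lambda$ an infinite group and $\varphi\colon\mathbb Z^2\to\Lambda$ a surjective homomorphism. Give the torus $\mathbb T^2=\mathbb R^2/\mathbb Z^2$ its product cell structure (one $0$-cell, two $1$-cells, one $2$-cell), let $C_*(\mathbb R^2)$ be the cellular chain complex over $\mathbb C$ of its universal cover, and let $\mathbb Z^2$ act on $C_*(\mathbb R^2)\otimes_{\mathbb C}V$ by $\gamma\otimes\rho(\gamma)$. A choice of an orientation and of a lift to $\mathbb R^2$ for each cell of $\mathbb T^2$, together with a basis of $V$, makes $\mathbb C\Lambda\otimes_{\mathbb C[\mathbb Z^2]}\bigl(C_*(\mathbb R^2)\otimes_{\mathbb C}V\bigr)$ a complex of finitely generated based free $\mathbb C\Lambda$-modules. Let $C_*^{(2)}=C_*^{(2)}(\mathbb T^2,\mathcal N\Lambda\otimes\rho)$ be its $L^2$-completion, a complex of Hilbert modules $\ell^2(\Lambda)^{n_p}$ over the group von Neumann algebra $\mathcal N\Lambda$ with boundary operators $d_p\colon C^{(2)}_p\to C^{(2)}_{p-1}$,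 and let $\Delta_p=d_{p+1}d_{p+1}^*+d_p^*d_p$. For a positive $\Lambda$-equivariant bounded operator $A$ on $\ell^2(\Lambda)^n$ let $\mu_A$ be its spectral measure with respect to the von Neumann trace, that is, $\int f\,d\mu_A=\operatorname{tr}_{\mathcal N\Lambda}f(A)$ for continuous compactly supported $f\colon\mathbb R\to\mathbb R$, and let $\det_{\mathcal N\Lambda}(A)=\exp\int_{(0,\infty)}\log t\,d\mu_A(t)$ be its Fuglede--Kadison determinant, which is $0$ if the integral is $-\infty$. Then, for every choice of orientations, lifts and basis of $V$: 1. $C_*^{(2)}$ is $L^2$-acyclic, that is, $\overline{\operatorname{im} d_{p+1}}=\ker d_p$ for all $p\ge 0$ (where $d_0=0$); 2. $C_*^{(2)}$ is of determinant class, that is, $\det_{\mathcal N\Lambda}(\Delta_p)>0$ for all $p$; 3. its $L^2$-torsion, the positive number $\tau^{(2)}$ with $\bigl(\tau^{(2)}\bigr)^2=\prod_{p=0}^{2}\det_{\mathcal N\Lambda}(\Delta_p)^{(-1)^p p}$, equals $1$. -/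

import Mathlib

open MeasureTheory
open scoped ENNReal InnerProductSpace CompactlySupported

noncomputable section

namespace L2Torsion

universe u v w v'

/-! ### Finitely generated free Hilbert modules over the group von Neumann algebra -/

/-- The Hilbert space `ℓ²(Λ)`. -/
abbrev EllTwo (Λ : Type u) : Type u := lp (fun _ : Λ => ℂ) 2

/-- The free Hilbert `𝒩Λ`-module `ℓ²(Λ)^I` (orthogonal direct sum of copies of `ℓ²(Λ)`). It is the
`L²`-completion of the based free left `ℂΛ`-module `(ℂΛ)^I`. -/
abbrev FreeHilbert (Λ : Type u) (I : Type v) [Fintype I] : Type (max u v) :=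
  PiLp 2 (fun _ : I => EllTwo Λ)

/-- Right translation `δ_g ↦ δ_{gh}` on `ℓ²(Λ)`; it commutes with the left action of `Λ`. -/
def rightShift {Λ : Type u} [Group Λ] (h : Λ) : EllTwo Λ →ₗᵢ[ℂ] EllTwo Λ where
  toFun x := ⟨fun g => x (g * h⁻¹), by
    have hx := (memℓp_gen_iff (E := fun _ : Λ => ℂ) (p := 2) (by norm_num)).1 (lp.memℓp x)
    exact memℓp_gen (hx.comp_injective (mul_left_injective h⁻¹))⟩
  map_add' x y := by ext g; rfl
  map_smul' c x := by ext g; rfl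
  norm_map' x := by
    have h2 : (0 : ℝ) < (2 : ℝ≥0∞).toReal := by norm_num
    rw [lp.norm_eq_tsum_rpow h2, lp.norm_eq_tsum_rpow h2]
    congr 1
    exact (Equiv.mulRight h⁻¹).tsum_eq (fun g => ‖x g‖ ^ (2 : ℝ≥0∞).toReal)

/-- The bounded operator `ℓ²(Λ) → ℓ²(Λ)`, `x ↦ x · a`, for an element `a` of the group ring. -/
def rightMul {Λ : Type u} [Group Λ] (a : MonoidAlgebra ℂ Λ) : EllTwo Λ →L[ℂ] EllTwo Λ :=
  a.coeff.sum fun h c => c • (rightShift h).toContinuousLinearMap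

/-- The bounded `Λ`-equivariant operator `ℓ²(Λ)^I → ℓ²(Λ)^J`, `x ↦ x · A` (row vectors), given by
a matrix over the group ring. -/
def matrixOp {Λ : Type u} [Group Λ] {I : Type v} {J : Type w} [Fintype I] [Fintype J]
    (A : Matrix I J (MonoidAlgebra ℂ Λ)) : FreeHilbert Λ I →L[ℂ] FreeHilbert Λ J :=
  (PiLp.continuousLinearEquiv 2 ℂ (fun _ : J => EllTwo Λ)).symm.toContinuousLinearMap ∘L
    ContinuousLinearMap.pi fun j => ∑ i, rightMul (A i j) ∘L PiLp.proj 2 (fun _ : I => EllTwo Λ) i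

open Classical in
/-- The vector of `ℓ²(Λ)^I` with `i`-th component `δ_1` and all others zero. -/
def unitVec (Λ : Type u) [Group Λ] {I : Type v} [Fintype I] (i : I) : FreeHilbert Λ I :=
  PiLp.single 2 i (lp.single 2 (1 : Λ) (1 : ℂ))

/-! ### Fuglede–Kadison determinant -/

/-- For a self-adjoint operator `A` on a Hilbert space and finitely many vectors `e i`, the positive
functional `f ↦ ∑ i, ⟨e i, f(A) (e i)⟩` on `C_c(ℝ)` (it is zero if `A` is not self-adjoint). -/
def vectorFunctional {H : Type u} [NormedAddCommGroup H] [InnerProductSpace ℂ H] [CompleteSpace H]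
    {I : Type v} [Fintype I] (e : I → H) (A : H →L[ℂ] H) : C_c(ℝ, ℝ) →ₚ[ℝ] ℝ :=
  PositiveLinearMap.mk₀
    { toFun := fun f => (∑ i, ⟪e i, cfc (f : ℝ → ℝ) A (e i)⟫_ℂ).re
      map_add' := fun f g => by
        have h : cfc ((f + g : C_c(ℝ, ℝ)) : ℝ → ℝ) A = cfc (f : ℝ → ℝ) A + cfc (g : ℝ → ℝ) A :=
          cfc_add (a := A) f g f.continuous.continuousOn g.continuous.continuousOn
        simp only [h, add_apply, inner_add_right, Finset.sum_add_distrib, Complex.add_re]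
      map_smul' := fun c f => by
        have h : cfc ((c • f : C_c(ℝ, ℝ)) : ℝ → ℝ) A = c • cfc (f : ℝ → ℝ) A :=
          cfc_smul c f A f.continuous.continuousOn
        simp only [h, smul_apply, inner_smul_right_eq_smul, ← Finset.smul_sum,
          Complex.smul_re, RingHom.id_apply] }
    (fun f hf => by
      have h : 0 ≤ cfc (f : ℝ → ℝ) A := cfc_nonneg fun x _ => hf x
      have h' := (ContinuousLinearMap.nonneg_iff_isPositive _).1 h
      simp only [LinearMap.coe_mk, AddHom.coe_mk, Complex.re_sum]
      exact Finset.sum_nonneg fun i _ => h'.re_inner_nonneg_right _)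

/-- The positive functional `f ↦ tr_{𝒩Λ} f(A)` on `C_c(ℝ)`, for self-adjoint `A`; here
`tr_{𝒩Λ} T = ∑ i, ⟨u_i, T u_i⟩`, where `u_i` is `δ_1` in the `i`-th component, is the von Neumann
trace of an endomorphism `T` of `ℓ²(Λ)^I`. -/
def traceFunctional {Λ : Type u} [Group Λ] {I : Type v} [Fintype I]
    (A : FreeHilbert Λ I →L[ℂ] FreeHilbert Λ I) : C_c(ℝ, ℝ) →ₚ[ℝ] ℝ :=
  vectorFunctional (unitVec Λ) A

/-- The spectral measure of a self-adjoint `A` with respect to the von Neumann trace: the measure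
`μ` on `ℝ` with `∫ f dμ = tr_{𝒩Λ} f(A)` for `f ∈ C_c(ℝ)`. If `E_t` is the family of spectral
projections of `A`, then `μ (-∞, t] = tr_{𝒩Λ} E_t`, i.e. for positive `A` this is the
Lebesgue–Stieltjes measure of the spectral density function of `A`. -/
def spectralMeasure {Λ : Type u} [Group Λ] {I : Type v} [Fintype I]
    (A : FreeHilbert Λ I →L[ℂ] FreeHilbert Λ I) : Measure ℝ :=
  RealRMK.rieszMeasure (traceFunctional A)

open Classical in
/-- The Fuglede–Kadison determinant of a positive operator `A`,
`det A = exp (tr log A) = exp (∫_{(0,∞)} log t dμ_A(t))`, which is `0` if the integral diverges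
(the integrand is bounded above on the compact spectrum, so it can only diverge to `-∞`). -/
def fkDet {Λ : Type u} [Group Λ] {I : Type v} [Fintype I]
    (A : FreeHilbert Λ I →L[ℂ] FreeHilbert Λ I) : ℝ :=
  if IntegrableOn Real.log (Set.Ioi 0) (spectralMeasure A) then
    Real.exp (∫ t in Set.Ioi 0, Real.log t ∂(spectralMeasure A))
  else 0

/-! ### Based free chain complexes and their `L²`-invariants -/

/-- A finite chain complex `⋯ → C_{p+1} → C_p → ⋯ → C_0` of finitely generated based free left
`ℂΛ`-modules. The index `ι p` is the basis of `C_p`; the row `a` of `d p` holds the coordinates of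
the boundary of the basis vector `a` of `C_{p+1}`. -/
structure BasedComplex (Λ : Type u) [Group Λ] where
  /-- the basis of the module in degree `p` -/
  ι : ℕ → Type v
  [fintype : ∀ p, Fintype (ι p)]
  /-- the modules vanish in degrees above `dim` -/
  dim : ℕ
  isEmpty : ∀ p, dim < p → IsEmpty (ι p)
  /-- the matrix of the boundary map `C_{p+1} → C_p` -/
  d : ∀ p, Matrix (ι (p + 1)) (ι p) (MonoidAlgebra ℂ Λ)
  d_mul_d : ∀ p, d (p + 1) * d p = 0

attribute [instance] BasedComplex.fintype

namespace BasedComplex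

variable {Λ : Type u} [Group Λ] (C : BasedComplex.{u, v} Λ)

/-- The boundary operator `ℓ²(Λ)^{ι (p+1)} → ℓ²(Λ)^{ι p}` of the `L²`-completion. -/
def bd (p : ℕ) : FreeHilbert Λ (C.ι (p + 1)) →L[ℂ] FreeHilbert Λ (C.ι p) := matrixOp (C.d p)

/-- The reduced `L²`-homology vanishes: in every degree the image of the incoming boundary operator
is dense in the kernel of the outgoing one (in degree `0` the outgoing one is zero). -/
def IsL2Acyclic : Prop :=
  (C.bd 0).range.topologicalClosure = ⊤ ∧
    ∀ p, (C.bd (p + 1)).range.topologicalClosure = (C.bd p).ker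

/-- The combinatorial Laplace operators of the `L²`-completion. -/
def laplacian : ∀ p, FreeHilbert Λ (C.ι p) →L[ℂ] FreeHilbert Λ (C.ι p)
  | 0 => C.bd 0 ∘L (C.bd 0).adjoint
  | p + 1 => C.bd (p + 1) ∘L (C.bd (p + 1)).adjoint + (C.bd p).adjoint ∘L C.bd p

/-- All combinatorial Laplace operators have positive Fuglede–Kadison determinant. -/
def IsDetClass : Prop := ∀ p, 0 < fkDet (C.laplacian p)

open Classical in
/-- The `L²`-torsion: the positive number with
`τ² = ∏_p det(Δ_p)^{(-1)^p p}`, and `0` unless the complex is `L²`-acyclic and of determinant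
class. -/
def torsion : ℝ :=
  if C.IsL2Acyclic ∧ C.IsDetClass then
    Real.sqrt (∏ p ∈ Finset.range (C.dim + 1), fkDet (C.laplacian p) ^ ((-1 : ℤ) ^ p * (p : ℤ)))
  else 0

end BasedComplex

/-! ### Twisting -/

section Twist

variable {π : Type u} [Group π] {Λ : Type v} [Group Λ] {V : Type*} [AddCommGroup V] [Module ℂ V]
  {J : Type w} [Fintype J] [DecidableEq J]

/-- The homomorphism `g ↦ φ(g) ⊗ ρ(g⁻¹)ᵀ` from `π` to matrices over `ℂΛ`, the matrix of `ρ` being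
taken in the basis `b`.

Let `C` be a based free left `ℂπ`-module with basis `(σ_s)`. With the diagonal action
`g (x ⊗ v) = g x ⊗ ρ(g) v`, the module `C ⊗_ℂ V` is free over `ℂπ` with basis `(σ_s ⊗ b_j)`, and
`g σ_t ⊗ b_j = g (σ_t ⊗ ρ(g⁻¹) b_j) = ∑ i, ρ(g⁻¹)_{ij} g (σ_t ⊗ b_i)`. -/
def twistHom (φ : π →* Λ) (ρ : π →* SpecialLinearGroup ℂ V) (b : Module.Basis J ℂ V) :
    π →* Matrix J J (MonoidAlgebra ℂ Λ) where
  toFun g := Matrix.of fun j i =>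
    MonoidAlgebra.single (φ g) (LinearMap.toMatrix b b ((ρ g⁻¹ : V ≃ₗ[ℂ] V) : V →ₗ[ℂ] V) i j)
  map_one' := by
    ext j i : 1
    simp only [inv_one, map_one, Matrix.of_apply, SpecialLinearGroup.coe_one]
    have h : ((1 : V ≃ₗ[ℂ] V) : V →ₗ[ℂ] V) = LinearMap.id := rfl
    rw [h, LinearMap.toMatrix_id, Matrix.one_apply, Matrix.one_apply]
    by_cases hij : i = j
    · subst hij; simp [MonoidAlgebra.one_def]
    · simp [hij, Ne.symm hij]
  map_mul' g h := by
    ext j i : 1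
    simp only [mul_inv_rev, map_mul, Matrix.of_apply, SpecialLinearGroup.coe_mul, Matrix.mul_apply,
      MonoidAlgebra.single_mul_single]
    have e : ((((ρ h⁻¹ : V ≃ₗ[ℂ] V) * (ρ g⁻¹ : V ≃ₗ[ℂ] V) : V ≃ₗ[ℂ] V)) : V →ₗ[ℂ] V) =
      ((ρ h⁻¹ : V ≃ₗ[ℂ] V) : V →ₗ[ℂ] V) ∘ₗ ((ρ g⁻¹ : V ≃ₗ[ℂ] V) : V →ₗ[ℂ] V) := rfl
    rw [e, LinearMap.toMatrix_comp b b b, Matrix.mul_apply, ← MonoidAlgebra.singleAddHom_apply, map_sum]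
    exact Finset.sum_congr rfl fun k _ => by rw [mul_comm, MonoidAlgebra.singleAddHom_apply]

/-- The complex `ℂΛ ⊗_{ℂπ} (C ⊗_ℂ V)` of based free `ℂΛ`-modules, where `π` acts diagonally on
`C ⊗_ℂ V`, with the basis `1 ⊗ σ_s ⊗ b_j`. -/
def BasedComplex.twist (C : BasedComplex.{u, v'} π) (φ : π →* Λ)
    (ρ : π →* SpecialLinearGroup ℂ V) (b : Module.Basis J ℂ V) : BasedComplex.{v, max v' w} Λ where
  ι p := C.ι p × J
  dim := C.dim
  isEmpty p hp := by have := C.isEmpty p hp; infer_instance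
  d p := Matrix.comp _ _ _ _ _ ((C.d p).map (MonoidAlgebra.lift ℂ _ π (twistHom φ ρ b)))
  d_mul_d p := by
    have h := congrArg
      (fun M => Matrix.comp _ _ _ _ _ (M.map (MonoidAlgebra.lift ℂ _ π (twistHom φ ρ b))))
      (C.d_mul_d p)
    simp only [Matrix.map_mul] at h
    ext ⟨s, j⟩ ⟨t, i⟩ : 1
    have h' := congrFun (congrFun h (s, j)) (t, i)
    simp only [Matrix.comp_apply, Matrix.mul_apply, Matrix.sum_apply, Matrix.map_apply,
      Matrix.zero_apply, map_zero] at h' ⊢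
    rw [Fintype.sum_prod_type]
    exact h'

end Twist

/-! ### The torus -/

/-- The group `ℤ²`, written multiplicatively: the fundamental group of `𝕋² = ℝ²/ℤ²`. -/
abbrev ZTwo : Type := Multiplicative (Fin 2 → ℤ)

/-- The `p`-cells of `𝕋² = ℝ²/ℤ²` with its product cell structure: a set `S` of `p` coordinate
directions stands for the image of the open cube `{x | 0 < x_i < 1 for i ∈ S, x_i = 0 for i ∉ S}`.
So there is one `0`-cell, there are two `1`-cells and there is one `2`-cell. -/
abbrev TorusCell (p : ℕ) : Type := {S : Finset (Fin 2) // S.card = p}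

/-- The `p`-cells of the universal cover `ℝ²`: the pair `(S, k)` is the cube
`{x | k_i < x_i < k_i + 1 for i ∈ S, x_i = k_i for i ∉ S}`, oriented by the order of the
coordinates. The group `ℤ²` acts by translation of `k`. -/
abbrev PlaneCell (p : ℕ) : Type := TorusCell p × (Fin 2 → ℤ)

/-- The direction set of the two faces orthogonal to the direction `i`. -/
def TorusCell.face {p : ℕ} (S : TorusCell (p + 1)) (i : S.1) : TorusCell p :=
  ⟨S.1.erase i, by rw [Finset.card_erase_of_mem i.2, S.2]; rfl⟩

/-- The cellular boundary of a cube of the plane: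
`∂ (S, k) = ∑_{i ∈ S} (-1)^{#{j ∈ S | j < i}} ((S \ {i}, k + e_i) - (S \ {i}, k))`. -/
def planeBoundary {p : ℕ} (c : PlaneCell (p + 1)) : PlaneCell p →₀ ℤ :=
  ∑ i : c.1.1, (-1 : ℤ) ^ (c.1.1.filter (· < i.1)).card •
    (Finsupp.single (c.1.face i, c.2 + Pi.single i.1 1) 1 - Finsupp.single (c.1.face i, c.2) 1)

/-- A lift to the plane and an orientation for every cell of the torus: the cell `S` is lifted to
the cube `(S, corner S)`, with the standard orientation or its opposite according to `sign S`. -/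
structure CellLifts where
  /-- the corner of the lift -/
  corner : ∀ {p : ℕ}, TorusCell p → (Fin 2 → ℤ)
  /-- the orientation of the lift -/
  sign : ∀ {p : ℕ}, TorusCell p → ℤˣ

/-- The coordinates over `ℂ[ℤ²]` of the boundary of the lift of `S`: a cube `(T, k)` is the
translate of the lift of `T` by `k - corner T`, up to the sign of `T`. -/
def CellLifts.boundaryMatrix (L : CellLifts) (p : ℕ) :
    Matrix (TorusCell (p + 1)) (TorusCell p) (MonoidAlgebra ℂ ZTwo) :=
  Matrix.of fun S T => (planeBoundary (S, L.corner S)).sum fun c n =>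
    if c.1 = T then
      MonoidAlgebra.single (Multiplicative.ofAdd (c.2 - L.corner T))
        (((L.sign S : ℤ) * (L.sign T : ℤ) * n : ℤ) : ℂ)
    else 0

lemma CellLifts.boundaryMatrix_apply (L : CellLifts) (p : ℕ) (S : TorusCell (p + 1))
    (T : TorusCell p) :
    L.boundaryMatrix p S T = ∑ i : S.1, if S.face i = T then
      MonoidAlgebra.single (Multiplicative.ofAdd (L.corner S + Pi.single i.1 1 - L.corner T))
        (((L.sign S : ℤ) * (L.sign T : ℤ) * (-1 : ℤ) ^ (S.1.filter (· < i.1)).card : ℤ) : ℂ) -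
      MonoidAlgebra.single (Multiplicative.ofAdd (L.corner S - L.corner T))
        (((L.sign S : ℤ) * (L.sign T : ℤ) * (-1 : ℤ) ^ (S.1.filter (· < i.1)).card : ℤ) : ℂ)
      else 0 := by
  simp only [boundaryMatrix, Matrix.of_apply, planeBoundary]
  rw [← Finsupp.sum_finsetSum_index]
  · refine Finset.sum_congr rfl fun i _ => ?_
    rw [smul_sub, Finsupp.smul_single, Finsupp.smul_single, Finsupp.sum_sub_index,
      Finsupp.sum_single_index, Finsupp.sum_single_index]
    · split_ifs <;> simp
    · simp
    · simp
    · intro c m n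
      split_ifs
      · rw [mul_sub, Int.cast_sub, MonoidAlgebra.single_sub]
      · simp
  · intro c; simp
  · intro c m n
    split_ifs
    · rw [mul_add, Int.cast_add, MonoidAlgebra.single_add]
    · simp

lemma CellLifts.boundaryMatrix_mul (L : CellLifts) (p : ℕ) :
    L.boundaryMatrix (p + 1) * L.boundaryMatrix p = 0 := by
  ext S T : 1
  rcases p with _ | p
  · obtain ⟨S, hS⟩ := S
    obtain rfl : S = Finset.univ := Finset.card_eq_iff_eq_univ S |>.1 (by simpa using hS)
    have hT : T = ⟨∅, rfl⟩ := Subtype.ext (Finset.card_eq_zero.1 T.2)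
    subst hT
    have hu : (Finset.univ : Finset (TorusCell 1)) = {⟨{0}, rfl⟩, ⟨{1}, rfl⟩} := by decide
    rw [Matrix.mul_apply, hu, Finset.sum_pair (by decide)]
    simp only [boundaryMatrix_apply]
    have e2 : (Finset.univ : Finset ((Finset.univ : Finset (Fin 2)) : Finset (Fin 2))) =
      {⟨0, by decide⟩, ⟨1, by decide⟩} := by decide
    have e0 : (Finset.univ : Finset (({0} : Finset (Fin 2)))) = {⟨0, by decide⟩} := by decide
    have e1 : (Finset.univ : Finset (({1} : Finset (Fin 2)))) = {⟨1, by decide⟩} := by decide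
    rw [e2, e0, e1, Finset.sum_pair (by decide), Finset.sum_pair (by decide), Finset.sum_singleton,
      Finset.sum_singleton, if_neg (by decide +revert),
      if_pos (by decide +revert), if_pos (by decide), if_pos (by decide +revert),
      if_neg (by decide +revert), if_pos (by decide)]
    have c0 : ((Finset.univ : Finset (Fin 2)).filter (· < 0)).card = 0 := by decide
    have c1 : ((Finset.univ : Finset (Fin 2)).filter (· < 1)).card = 1 := by decide
    have c2 : (({0} : Finset (Fin 2)).filter (· < 0)).card = 0 := by decide
    have c3 : (({1} : Finset (Fin 2)).filter (· < 1)).card = 0 := by decide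
    have k : ∀ x : ℤˣ, ((x : ℤ) : ℂ) * ((x : ℤ) : ℂ) = 1 := fun x => by
      rw [← Int.cast_mul, Int.units_coe_mul_self, Int.cast_one]
    have k0 : ∀ (x : ℤˣ) (z y : ℂ), z * ((x : ℤ) : ℂ) * -1 * (((x : ℤ) : ℂ) * y * 1) = -(z * y) :=
      fun x z y => by linear_combination -z * y * k x
    have k1 : ∀ (x : ℤˣ) (z y : ℂ), z * ((x : ℤ) : ℂ) * 1 * (((x : ℤ) : ℂ) * y * 1) = z * y :=
      fun x z y => by linear_combination z * y * k x
    have a1 : ∀ s t a b u : Fin 2 → ℤ, s + a - u + (u + b - t) = s - t + (a + b) := by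
      intros; abel
    have a2 : ∀ s t a u : Fin 2 → ℤ, s + a - u + (u - t) = s - t + a := by intros; abel
    have a3 : ∀ s t b u : Fin 2 → ℤ, s - u + (u + b - t) = s - t + b := by intros; abel
    have a4 : ∀ s t u : Fin 2 → ℤ, s - u + (u - t) = s - t := by intros; abel
    simp only [c0, c1, c2, c3, zero_add, add_zero, sub_mul, mul_sub, MonoidAlgebra.single_mul_single, ← ofAdd_add,
      Int.cast_mul, pow_zero, pow_one, Int.cast_one, Int.cast_neg]
    simp only [a1, a2, a3, a4, k0, k1, MonoidAlgebra.single_neg, Matrix.zero_apply]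
    rw [add_comm (Pi.single 1 1 : Fin 2 → ℤ)]
    abel
  · exfalso
    have h := S.2
    have h2 := Finset.card_le_univ S.1
    simp at h2
    omega

/-- The cellular chain complex over `ℂ` of the universal cover `ℝ²` of `𝕋²`, as a complex of free
`ℂ[ℤ²]`-modules based by the chosen oriented lifts of the cells. -/
def torusComplex (L : CellLifts) : BasedComplex.{0, 0} ZTwo where
  ι := TorusCell
  dim := 2
  isEmpty p hp := ⟨fun S => by
    have h := S.2
    have h2 := Finset.card_le_univ S.1
    simp at h2
    omega⟩
  d := L.boundaryMatrix
  d_mul_d := L.boundaryMatrix_mul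

end L2Torsion

end

open MeasureTheory
open scoped ENNReal InnerProductSpace CompactlySupported

noncomputable section

/-! As a quotient of ℤ², the group Λ is abelian, so the invariants can be computed by Fourier
transform on its compact dual. A matrix over ℂΛ becomes a continuous family of complex matrices
`evalMat χ A`, and the von Neumann trace becomes the integral of the ordinary trace against
normalized Haar measure. Hence the Fuglede–Kadison determinant attached to N*N is exp ∫ log det
(N*N)(χ) dχ as soon as this logarithm is integrable and the determinant is almost everywhere nonzero
(`fkDet_matrixOp_conjTranspose_mul_self`).

The twisted complex is the Koszul complex of two commuting matrices P and Q, the twisted boundaries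
of the two edges, up to a factor U in degree two that absorbs lifts and orientations. Since ρ takes
values in SL(V), |det U| = 1 at every character. Put δ = det (P*P + Q*Q). Because P and Q commute,
the Laplacians in degrees 0, 1, 2 have pointwise determinants δ, δ², δ almost everywhere
(`det_koszul_one`, `det_koszul_two`). With E = exp ∫ log δ this gives τ² = (E²)⁻¹ · E² = 1.

What remains is integrability of log δ and acyclicity. As Λ is infinite, the image x of one of the
two generators has infinite order, and the corresponding determinant, say det P, is a unit times a
monic polynomial in x. The values χ(x) are equidistributed on the circle, so log |det P| is
integrable (`integrable_log_norm_eval_dual`), and δ ≥ |det P|² bounds log δ from below. The same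
polynomial acts injectively on ℓ²(Λ) (`rightMul_injective_aeval`), while the adjugate of P supplies
a null-homotopy of det P · id (`koszul_homotopy_left`); together they force L²-acyclicity
(`BasedComplex.isL2Acyclic_of_homotopy`). -/

namespace L2Torsion

universe u v w v'

/-! ### The commutative group ring with its involution, acting on ℓ²(Λ). -/

section GroupRing

variable {Λ : Type u} [CommGroup Λ]

/-- Complex conjugation of the coefficients combined with inversion in the group. -/
def conjHom : MonoidAlgebra ℂ Λ →+* MonoidAlgebra ℂ Λ :=
  (MonoidAlgebra.mapRingHom Λ (starRingEnd ℂ)).comp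
    (MonoidAlgebra.mapDomainRingHom ℂ (invMonoidHom : Λ →* Λ))

lemma conjHom_single (g : Λ) (c : ℂ) :
    conjHom (MonoidAlgebra.single g c) = MonoidAlgebra.single g⁻¹ (starRingEnd ℂ c) := by
  simp [conjHom]

/-- This involution is the one for which `Matrix.conjTranspose` over ℂΛ corresponds to the Hilbert
space adjoint. -/
instance : StarRing (MonoidAlgebra ℂ Λ) where
  star := conjHom
  star_involutive a := by
    induction a using MonoidAlgebra.induction_linear with
    | zero => simp
    | add a b ha hb => simp only [map_add, ha, hb]
    | single g c => simp [conjHom_single]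
  star_mul a b := by
    change conjHom (a * b) = conjHom b * conjHom a
    rw [map_mul, mul_comm]
  star_add a b := map_add conjHom a b

lemma star_single (g : Λ) (c : ℂ) :
    star (MonoidAlgebra.single g c) = MonoidAlgebra.single g⁻¹ (starRingEnd ℂ c) :=
  conjHom_single g c

lemma rightShift_apply (h g : Λ) (x : EllTwo Λ) : rightShift h x g = x (g * h⁻¹) := rfl

/-- Right translation as a representation of the commutative group `Λ`. -/
def shiftHom : Λ →* (EllTwo Λ →L[ℂ] EllTwo Λ) where
  toFun h := (rightShift h).toContinuousLinearMap
  map_one' := by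
    ext x g
    simp [rightShift_apply]
  map_mul' h k := by
    ext x g
    simp only [LinearIsometry.coe_toContinuousLinearMap, mul_apply_eq_comp,
      rightShift_apply]
    rw [mul_inv, mul_assoc]

lemma rightMul_eq_lift (a : MonoidAlgebra ℂ Λ) :
    rightMul a = MonoidAlgebra.lift ℂ _ Λ shiftHom a := by
  rw [MonoidAlgebra.lift_apply]
  rfl

lemma rightMul_single (g : Λ) (c : ℂ) :
    rightMul (MonoidAlgebra.single g c) = c • (rightShift g).toContinuousLinearMap := by
  rw [rightMul_eq_lift, MonoidAlgebra.lift_single]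
  rfl

lemma rightMul_zero : rightMul (0 : MonoidAlgebra ℂ Λ) = 0 := by
  rw [rightMul_eq_lift, map_zero]

lemma rightMul_one : rightMul (1 : MonoidAlgebra ℂ Λ) = 1 := by
  rw [rightMul_eq_lift, map_one]

lemma rightMul_add (a b : MonoidAlgebra ℂ Λ) : rightMul (a + b) = rightMul a + rightMul b := by
  simp only [rightMul_eq_lift, map_add]

lemma rightMul_sum {ι : Type*} (s : Finset ι) (a : ι → MonoidAlgebra ℂ Λ) :
    rightMul (∑ i ∈ s, a i) = ∑ i ∈ s, rightMul (a i) := by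
  simp only [rightMul_eq_lift, map_sum]

lemma rightMul_mul (a b : MonoidAlgebra ℂ Λ) : rightMul (a * b) = rightMul a ∘L rightMul b := by
  simp only [rightMul_eq_lift, map_mul]
  rfl

lemma rightMul_apply_mul (a b : MonoidAlgebra ℂ Λ) (x : EllTwo Λ) :
    rightMul (a * b) x = rightMul a (rightMul b x) := by
  rw [rightMul_mul]
  rfl

lemma inner_rightShift_left (h : Λ) (x y : EllTwo Λ) :
    ⟪rightShift h x, y⟫_ℂ = ⟪x, rightShift h⁻¹ y⟫_ℂ := by
  rw [← (rightShift h).inner_map_map x]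
  congr 1
  ext g
  simp [rightShift_apply]

/-- Translations are unitary, so passing to the adjoint inverts group elements and conjugates
coefficients. -/
lemma inner_rightMul_left (a : MonoidAlgebra ℂ Λ) (x y : EllTwo Λ) :
    ⟪rightMul a x, y⟫_ℂ = ⟪x, rightMul (star a) y⟫_ℂ := by
  induction a using MonoidAlgebra.induction_linear with
  | zero => simp [rightMul_zero]
  | add a b ha hb =>
    simp only [star_add, rightMul_add, add_apply, inner_add_left,
      inner_add_right, ha, hb]
  | single g c =>
    simp only [star_single, rightMul_single, smul_apply, inner_smul_left,
      inner_smul_right, LinearIsometry.coe_toContinuousLinearMap, inner_rightShift_left]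

lemma rightMul_single_one_apply_one (a : MonoidAlgebra ℂ Λ) [DecidableEq Λ] :
    rightMul a (lp.single 2 (1 : Λ) (1 : ℂ)) 1 = a.coeff 1 := by
  induction a using MonoidAlgebra.induction_linear with
  | zero => simp [rightMul_zero]
  | add a b ha hb => simp [rightMul_add, ha, hb]
  | single g c =>
    simp only [rightMul_single, smul_apply, lp.coeFn_smul, Pi.smul_apply,
      LinearIsometry.coe_toContinuousLinearMap, rightShift_apply, MonoidAlgebra.coeff_single]
    by_cases hg : g = 1
    · subst hg; simp
    · have : (1 * g⁻¹ : Λ) ≠ 1 := by simpa using hg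
      simp [lp.single_apply, hg]

end GroupRing

/-! ### Matrices over the group ring as operators, their adjoints and traces. -/

section MatrixOp

variable {Λ : Type u} [CommGroup Λ] {I : Type v} {J : Type w} {K : Type v'}
  [Fintype I] [Fintype J] [Fintype K]

lemma matrixOp_apply (A : Matrix I J (MonoidAlgebra ℂ Λ)) (x : FreeHilbert Λ I) (j : J) :
    matrixOp A x j = ∑ i, rightMul (A i j) (x i) := by
  simp [matrixOp]

lemma matrixOp_zero : matrixOp (0 : Matrix I J (MonoidAlgebra ℂ Λ)) = 0 := by
  ext x j : 2
  simp [matrixOp_apply, rightMul_zero]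

lemma matrixOp_add (A B : Matrix I J (MonoidAlgebra ℂ Λ)) :
    matrixOp (A + B) = matrixOp A + matrixOp B := by
  ext x j : 2
  simp [matrixOp_apply, rightMul_add, Finset.sum_add_distrib]

/-- Matrices act on row vectors, hence the reversed order of composition; inside an entry the order
does not matter since ℂΛ is commutative. -/
lemma matrixOp_mul (A : Matrix I J (MonoidAlgebra ℂ Λ)) (B : Matrix J K (MonoidAlgebra ℂ Λ)) :
    matrixOp (A * B) = matrixOp B ∘L matrixOp A := by
  ext x k : 2
  simp only [matrixOp_apply, ContinuousLinearMap.comp_apply, Matrix.mul_apply, rightMul_sum,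
    sum_apply, map_sum]
  rw [Finset.sum_comm]
  exact Finset.sum_congr rfl fun j _ => Finset.sum_congr rfl fun i _ => by
    rw [mul_comm, rightMul_apply_mul]

lemma matrixOp_one [DecidableEq I] : matrixOp (1 : Matrix I I (MonoidAlgebra ℂ Λ)) = 1 := by
  ext x j : 2
  rw [matrixOp_apply, Finset.sum_eq_single j]
  · simp [rightMul_one]
  · intro i _ hij
    rw [Matrix.one_apply_ne hij, rightMul_zero]
    rfl
  · simp

lemma matrixOp_pow [DecidableEq I] (A : Matrix I I (MonoidAlgebra ℂ Λ)) (n : ℕ) :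
    matrixOp (A ^ n) = matrixOp A ^ n := by
  induction n with
  | zero => rw [pow_zero, pow_zero, matrixOp_one]
  | succ n ih => rw [pow_succ, matrixOp_mul, ih, pow_succ']; rfl

lemma matrixOp_adjoint (A : Matrix I J (MonoidAlgebra ℂ Λ)) :
    (matrixOp A).adjoint = matrixOp A.conjTranspose := by
  symm
  rw [ContinuousLinearMap.eq_adjoint_iff]
  intro x y
  simp only [PiLp.inner_apply, matrixOp_apply, sum_inner, inner_sum, Matrix.conjTranspose_apply,
    inner_rightMul_left, star_star]
  rw [Finset.sum_comm]

lemma inner_unitVec_matrixOp (A : Matrix I I (MonoidAlgebra ℂ Λ)) (i : I) :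
    ⟪unitVec Λ i, matrixOp A (unitVec Λ i)⟫_ℂ = (A i i).coeff 1 := by
  classical
  rw [PiLp.inner_apply, Finset.sum_eq_single i]
  · rw [matrixOp_apply, Finset.sum_eq_single i]
    · simp only [unitVec, PiLp.single_apply, if_true]
      rw [lp.inner_single_left, rightMul_single_one_apply_one]
      simp
    · intro k _ hk
      simp [unitVec, hk]
    · simp
  · intro k _ hk
    simp [unitVec, hk]
  · simp

lemma norm_unitVec (i : I) : ‖unitVec Λ i‖ = 1 := by
  classical
  simp [unitVec, PiLp.norm_single, lp.norm_single]

end MatrixOp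

/-! ### Fourier transform on the Pontryagin dual. -/

section Dual

variable {Λ : Type u} [CommGroup Λ]

/-- The embedding of `ℚ/ℤ` into the circle. -/
def ratCircleHom : AddCircle (1 : ℚ) →+ Additive Circle :=
  QuotientAddGroup.lift _
    ({ toFun := fun q => Additive.ofMul (Circle.exp (2 * Real.pi * (q : ℝ)))
       map_zero' := by simp
       map_add' := fun p q => by
        rw [← ofMul_mul, ← Circle.exp_add]
        push_cast
        rw [mul_add] } : ℚ →+ Additive Circle)
    (by
      intro q hq
      obtain ⟨n, rfl⟩ := AddSubgroup.mem_zmultiples_iff.1 hq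
      have := Circle.exp_two_pi_mul_int n
      simpa using this)

lemma ratCircleHom_eq_zero {t : AddCircle (1 : ℚ)} (ht : ratCircleHom t = 0) : t = 0 := by
  induction t using QuotientAddGroup.induction_on with
  | H q =>
    have h : Circle.exp (2 * Real.pi * (q : ℝ)) = 1 := ht
    obtain ⟨n, hn⟩ := Circle.exp_eq_one.1 h
    have hq : (q : ℝ) = n := by
      have := Real.pi_pos
      field_simp at hn
      linarith
    have hq' : q = n := by exact_mod_cast hq
    rw [QuotientAddGroup.eq_zero_iff]
    exact AddSubgroup.mem_zmultiples_iff.2 ⟨n, by simp [hq']⟩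

variable [TopologicalSpace Λ]

instance : MeasurableSpace (PontryaginDual Λ) := borel _

instance : BorelSpace (PontryaginDual Λ) := ⟨rfl⟩

lemma continuous_dual_apply (g : Λ) : Continuous fun χ : PontryaginDual Λ => χ g :=
  ContinuousEvalConst.continuous_eval_const (F := Λ →ₜ* Circle) g

/-- Evaluation of elements of the group ring at a character. -/
def evalChar (χ : PontryaginDual Λ) : MonoidAlgebra ℂ Λ →ₐ[ℂ] ℂ :=
  MonoidAlgebra.lift ℂ ℂ Λ (Circle.coeHom.comp (MonoidHomClass.toMonoidHom χ))

lemma evalChar_single (χ : PontryaginDual Λ) (g : Λ) (c : ℂ) :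
    evalChar χ (MonoidAlgebra.single g c) = c * χ g := by
  rw [evalChar, MonoidAlgebra.lift_single]
  rfl

lemma evalChar_star (χ : PontryaginDual Λ) (a : MonoidAlgebra ℂ Λ) :
    evalChar χ (star a) = star (evalChar χ a) := by
  induction a using MonoidAlgebra.induction_linear with
  | zero => simp
  | add a b ha hb => simp only [star_add, map_add, ha, hb]
  | single g c =>
    rw [star_single, evalChar_single, evalChar_single, map_inv, Circle.coe_inv_eq_conj]
    simp

lemma continuous_evalChar (a : MonoidAlgebra ℂ Λ) :
    Continuous fun χ : PontryaginDual Λ => evalChar χ a := by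
  induction a using MonoidAlgebra.induction_linear with
  | zero => simpa using continuous_const
  | add a b ha hb => simp only [map_add]; exact ha.add hb
  | single g c =>
    simp only [evalChar_single]
    exact continuous_const.mul (continuous_subtype_val.comp (continuous_dual_apply g))

/-- The matrix over `ℂ` obtained by evaluating a matrix over the group ring at a character. -/
def evalMat {I : Type*} {J : Type*} (χ : PontryaginDual Λ) (A : Matrix I J (MonoidAlgebra ℂ Λ)) :
    Matrix I J ℂ :=
  A.map (evalChar χ)

lemma evalMat_mul {I J K : Type*} [Fintype J] (χ : PontryaginDual Λ)
    (A : Matrix I J (MonoidAlgebra ℂ Λ)) (B : Matrix J K (MonoidAlgebra ℂ Λ)) :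
    evalMat χ (A * B) = evalMat χ A * evalMat χ B :=
  Matrix.map_mul

lemma evalMat_add {I J : Type*} (χ : PontryaginDual Λ) (A B : Matrix I J (MonoidAlgebra ℂ Λ)) :
    evalMat χ (A + B) = evalMat χ A + evalMat χ B :=
  Matrix.map_add _ (map_add _) A B

lemma evalMat_neg {I J : Type*} (χ : PontryaginDual Λ) (A : Matrix I J (MonoidAlgebra ℂ Λ)) :
    evalMat χ (-A) = -evalMat χ A := by
  ext i j
  simp [evalMat]

lemma evalMat_pow {I : Type*} [Fintype I] [DecidableEq I] (χ : PontryaginDual Λ)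
    (A : Matrix I I (MonoidAlgebra ℂ Λ)) (n : ℕ) : evalMat χ (A ^ n) = evalMat χ A ^ n :=
  Matrix.map_pow A (evalChar χ).toRingHom n

lemma evalMat_conjTranspose {I J : Type*} (χ : PontryaginDual Λ)
    (A : Matrix I J (MonoidAlgebra ℂ Λ)) :
    evalMat χ A.conjTranspose = (evalMat χ A).conjTranspose := by
  ext i j
  simp [evalMat, evalChar_star]

lemma det_evalMat {I : Type*} [Fintype I] [DecidableEq I] (χ : PontryaginDual Λ)
    (A : Matrix I I (MonoidAlgebra ℂ Λ)) : (evalMat χ A).det = evalChar χ A.det :=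
  (AlgHom.map_det (evalChar χ) A).symm

lemma continuous_evalMat {I J : Type*} (A : Matrix I J (MonoidAlgebra ℂ Λ)) :
    Continuous fun χ : PontryaginDual Λ => evalMat χ A :=
  continuous_matrix fun i j => continuous_evalChar (A i j)

variable [DiscreteTopology Λ]

/-- The characters of a discrete abelian group separate points. -/
lemma exists_dual_apply_ne_one {g : Λ} (hg : g ≠ 1) : ∃ χ : PontryaginDual Λ, χ g ≠ 1 := by
  -- Characters into ℚ/ℤ separate points because ℚ/ℤ is an injective cogenerator; composing with the
  -- embedding into the circle keeps this.
  obtain ⟨c, hc⟩ := CharacterModule.exists_character_apply_ne_zero_of_ne_zero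
    (A := Additive Λ) (a := Additive.ofMul g) (by simpa using hg)
  let f : Λ →* Circle := AddMonoidHom.toMultiplicative (ratCircleHom.comp c)
  let χ : Λ →ₜ* Circle := ⟨f, continuous_of_discreteTopology⟩
  refine ⟨χ, fun h => hc (ratCircleHom_eq_zero ?_)⟩
  exact h

variable (Λ) in
/-- The normalized Haar measure on the dual group. -/
def dualMeasure : Measure (PontryaginDual Λ) := Measure.haarMeasure ⊤

instance : IsProbabilityMeasure (dualMeasure Λ) :=
  ⟨Measure.haarMeasure_self (K₀ := (⊤ : TopologicalSpace.PositiveCompacts (PontryaginDual Λ)))⟩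

/-- Translating by a character ψ with ψ(g) ≠ 1 multiplies the integral by ψ(g), while Haar
invariance leaves it unchanged. -/
lemma integral_dual_apply_of_ne_one {g : Λ} (hg : g ≠ 1) :
    ∫ χ : PontryaginDual Λ, (χ g : ℂ) ∂(dualMeasure Λ) = 0 := by
  obtain ⟨ψ, hψ⟩ := exists_dual_apply_ne_one hg
  have h : ∫ χ : PontryaginDual Λ, ((ψ * χ) g : ℂ) ∂(dualMeasure Λ) =
      ∫ χ : PontryaginDual Λ, (χ g : ℂ) ∂(dualMeasure Λ) := by
    unfold dualMeasure
    exact integral_mul_left_eq_self (fun χ : PontryaginDual Λ => (χ g : ℂ)) ψ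
  have h' : ∀ χ : PontryaginDual Λ, ((ψ * χ) g : ℂ) = ψ g * χ g := fun χ => by
    rw [← Circle.coe_mul]; rfl
  simp only [h', integral_const_mul] at h
  have h'' : ((ψ g : ℂ) - 1) * ∫ χ : PontryaginDual Λ, (χ g : ℂ) ∂(dualMeasure Λ) = 0 := by
    rw [sub_mul, h, one_mul, sub_self]
  refine (mul_eq_zero.1 h'').resolve_left fun h0 => hψ ?_
  exact Circle.ext (by simpa using sub_eq_zero.1 h0)

lemma integrable_of_continuous_dual {E : Type*} [NormedAddCommGroup E] {f : PontryaginDual Λ → E}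
    (hf : Continuous f) : Integrable f (dualMeasure Λ) :=
  hf.integrable_of_hasCompactSupport (HasCompactSupport.of_compactSpace f)

/-- Fourier inversion at the identity; combined with `inner_unitVec_matrixOp`, it turns the von
Neumann trace into an integral over the dual. -/
lemma integral_evalChar (a : MonoidAlgebra ℂ Λ) :
    ∫ χ, evalChar χ a ∂(dualMeasure Λ) = a.coeff 1 := by
  classical
  induction a using MonoidAlgebra.induction_linear with
  | zero => simp
  | add a b ha hb =>
    simp only [map_add]
    rw [integral_add (integrable_of_continuous_dual (continuous_evalChar a))
      (integrable_of_continuous_dual (continuous_evalChar b)), ha, hb]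
    rfl
  | single g c =>
    simp only [evalChar_single, integral_const_mul, MonoidAlgebra.coeff_single]
    by_cases hg : g = 1
    · subst hg; simp
    · rw [integral_dual_apply_of_ne_one hg, Finsupp.single_eq_of_ne (Ne.symm hg), mul_zero]

end Dual

/-! ### Traces and determinants of Hermitian matrices in terms of eigenvalues. -/

section HermitianMatrix

open scoped ComplexOrder

variable {I : Type*} [Fintype I]

lemma roots_prod_X_sub_C_eq_map (f : I → ℂ) :
    (∏ i, (Polynomial.X - Polynomial.C (f i))).roots = Finset.univ.val.map f := by
  rw [Polynomial.roots_prod _ _ (Finset.prod_ne_zero_iff.2 fun i _ => Polynomial.X_sub_C_ne_zero _)]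
  simp [Multiset.bind_singleton]

variable [DecidableEq I] {A : Matrix I I ℂ}

lemma trace_pow_eq_sum_eigenvalues (hA : A.IsHermitian) (n : ℕ) :
    (A ^ n).trace = ((∑ i, hA.eigenvalues i ^ n : ℝ) : ℂ) := by
  rw [← cfc_pow_id (R := ℝ) A n hA.isSelfAdjoint, Matrix.trace_eq_sum_roots_charpoly,
    hA.charpoly_cfc_eq, roots_prod_X_sub_C_eq_map]
  simp

lemma det_add_smul_one_eq_prod (hA : A.IsHermitian) (ε : ℝ) :
    (A + (ε : ℂ) • (1 : Matrix I I ℂ)).det = ((∏ i, (hA.eigenvalues i + ε) : ℝ) : ℂ) := by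
  have h : A + (ε : ℂ) • (1 : Matrix I I ℂ) = cfc (fun t : ℝ => t + ε) A := by
    rw [cfc_add_const ε (fun t : ℝ => t) A (by fun_prop) hA.isSelfAdjoint,
      cfc_id' ℝ A hA.isSelfAdjoint, Algebra.algebraMap_eq_smul_one]
    congr 1
  rw [h, Matrix.det_eq_prod_roots_charpoly, hA.charpoly_cfc_eq, roots_prod_X_sub_C_eq_map]
  simp

/-- Provides a bound on the eigenvalues that is continuous in the matrix, hence uniform over the
compact dual. -/
lemma eigenvalues_le_re_trace (hA : A.PosSemidef) (i : I) :
    hA.isHermitian.eigenvalues i ≤ A.trace.re := by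
  rw [hA.isHermitian.trace_eq_sum_eigenvalues]
  simp only [Complex.re_sum, RCLike.ofReal_eq_complex_ofReal, Complex.ofReal_re]
  exact Finset.single_le_sum (fun j _ => hA.eigenvalues_nonneg j) (Finset.mem_univ i)

end HermitianMatrix

/-! ### The spectral measure is determined by its moments. -/

section VectorFunctional

variable {H : Type u} [NormedAddCommGroup H] [InnerProductSpace ℂ H]
  {I : Type v} [Fintype I] {e : I → H} {A : H →L[ℂ] H} {c : ℝ}
  {X : Type w} [MeasurableSpace X] {ν : Measure X} {lam : X → I → ℝ}

lemma sum_inner_aeval (hpow : ∀ n : ℕ, Integrable (fun x => ∑ i, lam x i ^ n) ν ∧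
      (∑ i, ⟪e i, (A ^ n) (e i)⟫_ℂ).re = ∫ x, ∑ i, lam x i ^ n ∂ν) (q : Polynomial ℝ) :
    Integrable (fun x => ∑ i, q.eval (lam x i)) ν ∧
      (∑ i, ⟪e i, Polynomial.aeval A q (e i)⟫_ℂ).re = ∫ x, ∑ i, q.eval (lam x i) ∂ν := by
  induction q using Polynomial.induction_on' with
  | add p q hp hq =>
    simp only [map_add, add_apply, inner_add_right, Finset.sum_add_distrib, Complex.add_re,
      Polynomial.eval_add]
    exact ⟨hp.1.add hq.1, by rw [integral_add hp.1 hq.1, hp.2, hq.2]⟩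
  | monomial n a =>
    simp only [Polynomial.aeval_monomial, ← Algebra.smul_def, smul_apply,
      inner_smul_right_eq_smul, ← Finset.smul_sum, Polynomial.eval_monomial, ← Finset.mul_sum,
      Complex.smul_re, (hpow n).2, integral_const_mul]
    exact ⟨(hpow n).1.const_mul a, rfl⟩

variable [CompleteSpace H]

/-- If the moments `∑ i, ⟨e i, A ^ n (e i)⟩` are the integrals of the power sums of a family of
real numbers, then this holds with any continuous function in place of the powers. -/
lemma re_sum_inner_cfc_eq_integral [IsProbabilityMeasure ν] (hA : IsSelfAdjoint A)
    (hn : ∀ i, ‖e i‖ = 1) (hs : spectrum ℝ A ⊆ Set.Icc 0 c) (he : ∀ x i, lam x i ∈ Set.Icc 0 c)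
    (hpow : ∀ n : ℕ, Integrable (fun x => ∑ i, lam x i ^ n) ν ∧
      (∑ i, ⟪e i, (A ^ n) (e i)⟫_ℂ).re = ∫ x, ∑ i, lam x i ^ n ∂ν)
    {f : ℝ → ℝ} (hf : Continuous f) (hF : Integrable (fun x => ∑ i, f (lam x i)) ν) :
    (∑ i, ⟪e i, cfc f A (e i)⟫_ℂ).re = ∫ x, ∑ i, f (lam x i) ∂ν := by
  -- Weierstrass approximation: replacing f by a polynomial within ε on [0, c] costs at most nε on
  -- the operator side and nε on the integral side, and polynomials agree by the moment hypothesis.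
  set n : ℝ := (Fintype.card I : ℝ) with hn'
  have key : ∀ ε > 0, |(∑ i, ⟪e i, cfc f A (e i)⟫_ℂ).re - ∫ x, ∑ i, f (lam x i) ∂ν| ≤
      n * ε + n * ε := by
    intro ε hε
    obtain ⟨q, hq⟩ := exists_polynomial_near_of_continuousOn 0 c f hf.continuousOn ε hε
    obtain ⟨hq', h2⟩ := sum_inner_aeval hpow q
    have h1 : |(∑ i, ⟪e i, cfc f A (e i)⟫_ℂ).re -
        (∑ i, ⟪e i, Polynomial.aeval A q (e i)⟫_ℂ).re| ≤ n * ε := by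
      rw [← Complex.sub_re, ← Finset.sum_sub_distrib]
      refine (Complex.abs_re_le_norm _).trans ((norm_sum_le _ _).trans ?_)
      refine (Finset.sum_le_card_nsmul _ _ ε fun i _ => ?_).trans (by simp [hn'])
      rw [← inner_sub_right, ← sub_apply, ← cfc_polynomial q A hA,
        ← cfc_sub f (fun x => q.eval x) A hf.continuousOn q.continuous.continuousOn]
      refine (norm_inner_le_norm _ _).trans ?_
      rw [hn, one_mul]
      refine (ContinuousLinearMap.le_opNorm _ _).trans ?_
      rw [hn, mul_one]
      refine norm_cfc_le hε.le fun x hx => ?_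
      rw [Real.norm_eq_abs, abs_sub_comm]
      exact (hq x (hs hx)).le
    have h3 : |∫ x, ∑ i, q.eval (lam x i) ∂ν - ∫ x, ∑ i, f (lam x i) ∂ν| ≤ n * ε := by
      rw [← integral_sub hq' hF]
      have := norm_integral_le_of_norm_le_const (μ := ν) (C := n * ε)
        (f := fun x => ∑ i, q.eval (lam x i) - ∑ i, f (lam x i))
        (Filter.Eventually.of_forall fun x => by
          rw [← Finset.sum_sub_distrib]
          refine (norm_sum_le _ _).trans ?_
          refine (Finset.sum_le_card_nsmul _ _ ε fun i _ => ?_).trans (by simp [hn'])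
          exact (hq _ (he x i)).le)
      simpa using this
    rw [h2] at h1
    exact (abs_sub_le _ _ _).trans (add_le_add h1 h3)
  have hn0 : 0 ≤ n := by positivity
  rw [← sub_eq_zero, ← abs_eq_zero]
  refine le_antisymm (le_of_forall_pos_le_add fun δ hδ => ?_) (abs_nonneg _)
  refine (key (δ / (2 * (n + 1))) (by positivity)).trans ?_
  rw [zero_add, ← mul_add, ← add_div, ← mul_div_assoc, div_le_iff₀ (by positivity)]
  nlinarith

lemma vectorFunctional_apply (f : C_c(ℝ, ℝ)) :
    vectorFunctional e A f = (∑ i, ⟪e i, cfc (f : ℝ → ℝ) A (e i)⟫_ℂ).re := rfl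

/-- By inner regularity it suffices to treat compact K off [0, c]. A Urysohn function equal to 1 on
K and 0 on [0, c] vanishes on the spectrum, so its functional calculus at A is zero, and it
dominates the measure of K. -/
lemma rieszMeasure_compl_Icc (hs : spectrum ℝ A ⊆ Set.Icc 0 c) :
    RealRMK.rieszMeasure (vectorFunctional e A) (Set.Icc 0 c)ᶜ = 0 := by
  rw [isClosed_Icc.isOpen_compl.measure_eq_iSup_isCompact]
  simp only [ENNReal.iSup_eq_zero]
  intro K hK hKc
  obtain ⟨f, hf1, hf0, hfc, hf⟩ := exists_continuous_one_zero_of_isCompact hKc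
    (isClosed_Icc (a := (0 : ℝ)) (b := c)) (Set.disjoint_left.2 fun x hx => hK hx)
  let g : C_c(ℝ, ℝ) := ⟨f, hfc⟩
  have h := RealRMK.rieszMeasure_le_of_eq_one (vectorFunctional e A) (f := g)
    (fun x => (hf x).1) hKc hf1
  have h0 : vectorFunctional e A g = 0 := by
    have h1 : cfc (g : ℝ → ℝ) A = cfc (fun _ => 0 : ℝ → ℝ) A := cfc_congr fun x hx => hf0 (hs hx)
    rw [vectorFunctional_apply, h1, cfc_const_zero]
    simp
  rw [h0, ENNReal.ofReal_zero] at h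
  exact le_antisymm h bot_le

lemma isFiniteMeasure_rieszMeasure (hs : spectrum ℝ A ⊆ Set.Icc 0 c) :
    IsFiniteMeasure (RealRMK.rieszMeasure (vectorFunctional e A)) := by
  refine ⟨?_⟩
  rw [← Set.union_compl_self (Set.Icc 0 c)]
  refine (measure_union_le _ _).trans_lt ?_
  rw [rieszMeasure_compl_Icc hs, add_zero]
  exact isCompact_Icc.measure_lt_top

/-- The Riesz measure computes `∑ i, ⟨e i, f(A) (e i)⟩` for all continuous functions `f`. -/
lemma integral_rieszMeasure_vectorFunctional (hs : spectrum ℝ A ⊆ Set.Icc 0 c) {f : ℝ → ℝ}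
    (hf : Continuous f) :
    Integrable f (RealRMK.rieszMeasure (vectorFunctional e A)) ∧
      ∫ t, f t ∂(RealRMK.rieszMeasure (vectorFunctional e A)) =
        (∑ i, ⟪e i, cfc f A (e i)⟫_ℂ).re := by
  -- The functional is only defined on compactly supported functions; multiplying f by a cutoff
  -- equal to 1 on [0, c] changes neither side.
  obtain ⟨k, hk1, -, hkc, hk⟩ := exists_continuous_one_zero_of_isCompact
    (isCompact_Icc (a := (0 : ℝ)) (b := c)) isClosed_empty (Set.disjoint_empty _)
  let g : C_c(ℝ, ℝ) := ⟨⟨fun t => k t * f t, k.continuous.mul hf⟩, hkc.mul_right⟩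
  have hg : ∀ t ∈ Set.Icc 0 c, g t = f t := fun t ht => by
    have h1 : k t = 1 := hk1 ht
    change k t * f t = f t
    rw [h1, one_mul]
  have hae : (g : ℝ → ℝ) =ᵐ[RealRMK.rieszMeasure (vectorFunctional e A)] f := by
    have h0 : ∀ᵐ t ∂(RealRMK.rieszMeasure (vectorFunctional e A)), t ∈ Set.Icc 0 c := by
      rw [ae_iff]
      exact rieszMeasure_compl_Icc hs
    filter_upwards [h0] with t ht using hg t ht
  have hgi : Integrable g (RealRMK.rieszMeasure (vectorFunctional e A)) :=
    g.continuous.integrable_of_hasCompactSupport g.hasCompactSupport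
  refine ⟨hgi.congr hae, ?_⟩
  have hcfc : cfc (g : ℝ → ℝ) A = cfc f A := cfc_congr fun t ht => hg t (hs ht)
  rw [← integral_congr_ae hae, ← hcfc]
  exact RealRMK.integral_rieszMeasure (vectorFunctional e A) g

end VectorFunctional

/-! ### Integrating the logarithm by regularization and monotone convergence. -/

section LogLimit

open Filter Topology

variable {I : Type v} [Fintype I] {X : Type w} [MeasurableSpace X]

/-- Passing to the limit `ε → 0` in `∫ log (t + ε) dμ = ∫ ∑ i, log (lam x i + ε) dν`. -/
lemma integral_log_of_integral_log_add {μ : Measure ℝ} [IsFiniteMeasure μ] {ν : Measure X}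
    [IsProbabilityMeasure ν] {lam : X → I → ℝ} {c : ℝ}
    (hμ : ∀ᵐ t ∂μ, t ∈ Set.Icc 0 c) (hmass : μ.real Set.univ = Fintype.card I)
    (he : ∀ x i, lam x i ∈ Set.Icc 0 c)
    (hshift : ∀ ε > 0, Integrable (fun t => Real.log (|t| + ε)) μ ∧
      Integrable (fun x => ∑ i, Real.log (|lam x i| + ε)) ν ∧
      ∫ t, Real.log (|t| + ε) ∂μ = ∫ x, ∑ i, Real.log (|lam x i| + ε) ∂ν)
    (hpos : ∀ᵐ x ∂ν, ∀ i, lam x i ≠ 0) (hlog : Integrable (fun x => ∑ i, Real.log (lam x i)) ν) :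
    IntegrableOn Real.log (Set.Ioi 0) μ ∧
      ∫ t in Set.Ioi 0, Real.log t ∂μ = ∫ x, ∑ i, Real.log (lam x i) ∂ν := by
  -- As ε k ≤ 1, this constant bounds log (|t| + ε k) on [0, c], so the differences C − log (|t| + ε
  -- k) are nonnegative there and increase with k.
  set C : ℝ := Real.log (c + 1) with hC
  let ε : ℕ → ℝ := fun k => 1 / ((k : ℝ) + 1)
  have hε : ∀ k, 0 < ε k := fun k => by positivity
  have hε1 : ∀ k, ε k ≤ 1 := fun k => by
    rw [div_le_one (by positivity)]
    linarith [(Nat.cast_nonneg k : (0 : ℝ) ≤ k)]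
  have hεanti : Antitone ε := fun k l hkl => by
    have : (k : ℝ) ≤ l := by exact_mod_cast hkl
    exact one_div_le_one_div_of_le (by positivity) (by linarith)
  have hεlim : Tendsto ε atTop (𝓝 0) := tendsto_one_div_add_atTop_nhds_zero_nat
  have hnn : ∀ k, ∀ t ∈ Set.Icc 0 c, 0 ≤ C - Real.log (|t| + ε k) := fun k t ht => by
    rw [sub_nonneg]
    refine Real.log_le_log (by have := hε k; have := abs_nonneg t; linarith) ?_
    rw [abs_of_nonneg ht.1]
    exact add_le_add ht.2 (hε1 k)
  have hmono : ∀ t : ℝ, Monotone fun k => C - Real.log (|t| + ε k) := fun t k l hkl => by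
    refine sub_le_sub_left (Real.log_le_log ?_ ?_) _
    · have := hε l; have := abs_nonneg t; linarith
    · linarith [hεanti hkl]
  have hlim : ∀ t ∈ Set.Icc 0 c, t ≠ 0 →
      Tendsto (fun k => C - Real.log (|t| + ε k)) atTop (𝓝 (C - Real.log t)) := fun t ht h0 => by
    have h1 : Tendsto (fun k => |t| + ε k) atTop (𝓝 t) := by
      simpa [abs_of_nonneg ht.1] using (tendsto_const_nhds (x := t)).add hεlim
    exact tendsto_const_nhds.sub ((Real.continuousAt_log h0).tendsto.comp h1)
  -- The value ⊤ at 0 is the true monotone limit; `Real.log 0 = 0` would hide a possible atom of μ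
  -- at 0.
  let g : ℝ → ℝ≥0∞ := fun t => if t = 0 then ⊤ else ENNReal.ofReal (C - Real.log t)
  have hgm : Measurable g :=
    Measurable.ite (measurableSet_singleton 0) measurable_const
      (measurable_const.sub Real.measurable_log).ennreal_ofReal
  have hL : Tendsto (fun k => ∫⁻ t, ENNReal.ofReal (C - Real.log (|t| + ε k)) ∂μ) atTop
      (𝓝 (∫⁻ t, g t ∂μ)) := by
    refine lintegral_tendsto_of_tendsto_of_monotone (fun k => by fun_prop) ?_ ?_
    · exact Eventually.of_forall fun t k l hkl => ENNReal.ofReal_le_ofReal (hmono t hkl)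
    · filter_upwards [hμ] with t ht
      by_cases h0 : t = 0
      · subst h0
        simp only [g, if_true, abs_zero, zero_add]
        refine ENNReal.tendsto_ofReal_nhds_top.2 ?_
        have h1 : Tendsto ε atTop (𝓝[>] 0) :=
          tendsto_nhdsWithin_iff.2 ⟨hεlim, Eventually.of_forall hε⟩
        exact tendsto_atTop_add_const_left _ C
          (tendsto_neg_atBot_atTop.comp (Real.tendsto_log_nhdsGT_zero.comp h1))
      · simp only [g, if_neg h0]
        exact ENNReal.tendsto_ofReal (hlim t ht h0)
  have hGk : ∀ k, Integrable (fun x => ∑ i, (C - Real.log (|lam x i| + ε k))) ν := fun k => by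
    simp only [Finset.sum_sub_distrib]
    exact (integrable_const _).sub (hshift _ (hε k)).2.1
  have hG : Integrable (fun x => ∑ i, (C - Real.log (lam x i))) ν := by
    simp only [Finset.sum_sub_distrib]
    exact (integrable_const _).sub hlog
  have hR : Tendsto (fun k => ∫⁻ x, ENNReal.ofReal (∑ i, (C - Real.log (|lam x i| + ε k))) ∂ν) atTop
      (𝓝 (∫⁻ x, ENNReal.ofReal (∑ i, (C - Real.log (lam x i))) ∂ν)) := by
    refine lintegral_tendsto_of_tendsto_of_monotone
      (fun k => (hGk k).1.aemeasurable.ennreal_ofReal) ?_ ?_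
    · exact Eventually.of_forall fun x k l hkl =>
        ENNReal.ofReal_le_ofReal (Finset.sum_le_sum fun i _ => hmono _ hkl)
    · filter_upwards [hpos] with x hx
      exact ENNReal.tendsto_ofReal (tendsto_finsetSum _ fun i _ => hlim _ (he x i) (hx i))
  have hLR : ∀ k, ∫⁻ t, ENNReal.ofReal (C - Real.log (|t| + ε k)) ∂μ =
      ∫⁻ x, ENNReal.ofReal (∑ i, (C - Real.log (|lam x i| + ε k))) ∂ν := fun k => by
    obtain ⟨h1, h2, h3⟩ := hshift _ (hε k)
    have h1' : Integrable (fun t => C - Real.log (|t| + ε k)) μ := (integrable_const C).sub h1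
    rw [← ofReal_integral_eq_lintegral_ofReal h1'
      (by filter_upwards [hμ] with t ht using hnn k t ht),
      ← ofReal_integral_eq_lintegral_ofReal (hGk k)
      (Eventually.of_forall fun x => Finset.sum_nonneg fun i _ => hnn k _ (he x i))]
    congr 1
    simp only [Finset.sum_sub_distrib]
    rw [integral_sub (integrable_const C) h1, integral_sub (integrable_const _) h2, h3]
    simp [hmass]
  have hEq : ∫⁻ t, g t ∂μ = ∫⁻ x, ENNReal.ofReal (∑ i, (C - Real.log (lam x i))) ∂ν := by
    simp only [hLR] at hL
    exact tendsto_nhds_unique hL hR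
  have hGnn : 0 ≤ᵐ[ν] fun x => ∑ i, (C - Real.log (lam x i)) := by
    filter_upwards [hpos] with x hx
    refine Finset.sum_nonneg fun i _ => sub_nonneg.2 (Real.log_le_log ?_ ?_)
    · exact lt_of_le_of_ne (he x i).1 (hx i).symm
    · linarith [(he x i).2]
  have hfin : ∫⁻ t, g t ∂μ ≠ ⊤ := by
    rw [hEq, ← ofReal_integral_eq_lintegral_ofReal hG hGnn]
    exact ENNReal.ofReal_ne_top
  -- A finite integral of g leaves no mass at 0, where g is infinite; thus the restriction to (0, ∞)
  -- loses nothing.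
  have hne : ∀ᵐ t ∂μ, t ∈ Set.Ioi 0 := by
    filter_upwards [hμ, ae_lt_top hgm hfin] with t ht hgt
    refine lt_of_le_of_ne ht.1 fun h0 => ?_
    simp [g, ← h0] at hgt
  have hg' : ∫⁻ t, g t ∂μ = ∫⁻ t, ENNReal.ofReal (C - Real.log t) ∂μ := by
    refine lintegral_congr_ae ?_
    filter_upwards [hne] with t ht
    simp [g, (ne_of_gt ht : t ≠ 0)]
  have hnn' : 0 ≤ᵐ[μ] fun t => C - Real.log t := by
    filter_upwards [hμ, hne] with t ht h0
    exact sub_nonneg.2 (Real.log_le_log h0 (by linarith [ht.2]))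
  have hCi : Integrable (fun t => C - Real.log t) μ := by
    refine ⟨(measurable_const.sub Real.measurable_log).aestronglyMeasurable, ?_⟩
    rw [hasFiniteIntegral_iff_ofReal hnn', ← hg']
    exact lt_top_iff_ne_top.2 hfin
  have hli : Integrable Real.log μ := by
    have := (integrable_const C).sub hCi
    simpa [Pi.sub_def] using this
  have hval : ∫ t, (C - Real.log t) ∂μ = ∫ x, ∑ i, (C - Real.log (lam x i)) ∂ν := by
    rw [integral_eq_lintegral_of_nonneg_ae hnn' hCi.1, integral_eq_lintegral_of_nonneg_ae hGnn hG.1,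
      ← hg', hEq]
  simp only [Finset.sum_sub_distrib] at hval
  rw [integral_sub (integrable_const C) hli, integral_sub (integrable_const _) hlog] at hval
  refine ⟨hli.integrableOn, ?_⟩
  rw [Measure.restrict_eq_self_of_ae_mem hne]
  simp [hmass] at hval
  exact hval

end LogLimit

/-! ### The trace of the logarithm of a positive operator. -/

section PositiveOperator

variable {H : Type u} [NormedAddCommGroup H] [InnerProductSpace ℂ H] [CompleteSpace H]
  {I : Type v} [Fintype I] {e : I → H} {A : H →L[ℂ] H} {c : ℝ}
  {X : Type w} [MeasurableSpace X] {ν : Measure X} [IsProbabilityMeasure ν] {lam : X → I → ℝ}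

lemma spectrum_subset_Icc_of_isPositive (hA : A.IsPositive) (hc : ‖A‖ ≤ c) :
    spectrum ℝ A ⊆ Set.Icc 0 c := fun t ht => by
  have h0 : 0 ≤ A := (ContinuousLinearMap.nonneg_iff_isPositive A).2 hA
  refine ⟨spectrum_nonneg_of_nonneg h0 ht, ?_⟩
  rcases subsingleton_or_nontrivial H with h | h
  · simp [spectrum.of_subsingleton] at ht
  · exact (le_abs_self t).trans ((spectrum.norm_le_norm_of_mem ht).trans hc)

/-- If the moments of a positive operator are the integrals of the power sums of nonnegative
numbers `lam x i`, then its logarithm has trace `∫ ∑ i, log (lam x i)`. -/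
lemma integral_log_rieszMeasure (hA : A.IsPositive) (hn : ∀ i, ‖e i‖ = 1)
    (he : ∀ x i, lam x i ∈ Set.Icc 0 c)
    (hpow : ∀ n : ℕ, Integrable (fun x => ∑ i, lam x i ^ n) ν ∧
      (∑ i, ⟪e i, (A ^ n) (e i)⟫_ℂ).re = ∫ x, ∑ i, lam x i ^ n ∂ν)
    (hshift : ∀ ε > 0, Integrable (fun x => ∑ i, Real.log (|lam x i| + ε)) ν)
    (hpos : ∀ᵐ x ∂ν, ∀ i, lam x i ≠ 0) (hlog : Integrable (fun x => ∑ i, Real.log (lam x i)) ν) :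
    IntegrableOn Real.log (Set.Ioi 0) (RealRMK.rieszMeasure (vectorFunctional e A)) ∧
      ∫ t in Set.Ioi 0, Real.log t ∂(RealRMK.rieszMeasure (vectorFunctional e A)) =
        ∫ x, ∑ i, Real.log (lam x i) ∂ν := by
  set c' : ℝ := max c ‖A‖
  have hs : spectrum ℝ A ⊆ Set.Icc 0 c' := spectrum_subset_Icc_of_isPositive hA (le_max_right _ _)
  have he' : ∀ x i, lam x i ∈ Set.Icc 0 c' := fun x i =>
    ⟨(he x i).1, (he x i).2.trans (le_max_left _ _)⟩
  have := isFiniteMeasure_rieszMeasure (e := e) hs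
  have htr : ∀ {f : ℝ → ℝ}, Continuous f → Integrable (fun x => ∑ i, f (lam x i)) ν →
      ∫ t, f t ∂(RealRMK.rieszMeasure (vectorFunctional e A)) = ∫ x, ∑ i, f (lam x i) ∂ν :=
    fun hf hF => (integral_rieszMeasure_vectorFunctional hs hf).2.trans
      (re_sum_inner_cfc_eq_integral hA.isSelfAdjoint hn hs he' hpow hf hF)
  refine integral_log_of_integral_log_add ?_ ?_ he' ?_ hpos hlog
  · rw [ae_iff]
    exact rieszMeasure_compl_Icc hs
  · have := htr (f := fun _ => 1) continuous_const (by simp)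
    simpa using this
  · intro ε hε
    -- The absolute value makes the regularized logarithm continuous on all of ℝ, as the functional
    -- calculus lemmas require; it is invisible on [0, c'].
    have hf : Continuous fun t : ℝ => Real.log (|t| + ε) :=
      (continuous_abs.add continuous_const).log fun t => by
        exact (add_pos_of_nonneg_of_pos (abs_nonneg t) hε).ne'
    exact ⟨(integral_rieszMeasure_vectorFunctional hs hf).1, hshift ε hε, htr hf (hshift ε hε)⟩

end PositiveOperator

/-! ### Fuglede–Kadison determinants by Fourier transform. -/

section Determinant

open scoped ComplexOrder

variable {Λ : Type u} [CommGroup Λ] [TopologicalSpace Λ]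
  {I : Type v} [Fintype I]

lemma continuous_det_add_smul_one [DecidableEq I] (A : Matrix I I (MonoidAlgebra ℂ Λ)) (ε : ℂ) :
    Continuous fun χ : PontryaginDual Λ => (evalMat χ A + ε • (1 : Matrix I I ℂ)).det :=
  ((continuous_evalMat A).add continuous_const).matrix_det

variable [DiscreteTopology Λ]

lemma sum_inner_unitVec_matrixOp (A : Matrix I I (MonoidAlgebra ℂ Λ)) :
    ∑ i, ⟪unitVec Λ i, matrixOp A (unitVec Λ i)⟫_ℂ =
      ∫ χ, (evalMat χ A).trace ∂(dualMeasure Λ) := by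
  simp only [inner_unitVec_matrixOp, ← integral_evalChar]
  exact (integral_finsetSum _ fun i _ =>
    integrable_of_continuous_dual (continuous_evalChar (A i i))).symm

/-- The Fuglede–Kadison determinant of `N N*` as an integral over the dual group. -/
theorem fkDet_matrixOp_conjTranspose_mul_self [DecidableEq I] {K : Type w} [Fintype K]
    (N : Matrix K I (MonoidAlgebra ℂ Λ))
    (hne : ∀ᵐ χ ∂(dualMeasure Λ), (evalMat χ (N.conjTranspose * N)).det ≠ 0)
    (hlog : Integrable (fun χ => Real.log (evalMat χ (N.conjTranspose * N)).det.re)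
      (dualMeasure Λ)) :
    fkDet (matrixOp (N.conjTranspose * N)) =
      Real.exp (∫ χ, Real.log (evalMat χ (N.conjTranspose * N)).det.re ∂(dualMeasure Λ)) := by
  set M := N.conjTranspose * N with hM
  have hpsd : ∀ χ : PontryaginDual Λ, (evalMat χ M).PosSemidef := fun χ => by
    rw [hM, evalMat_mul, evalMat_conjTranspose]
    exact Matrix.posSemidef_conjTranspose_mul_self _
  -- No regularity in χ of a single eigenvalue is needed: every integrand below is symmetric in the
  -- eigenvalues and is rewritten through a trace or a determinant.
  let lam : PontryaginDual Λ → I → ℝ := fun χ => (hpsd χ).isHermitian.eigenvalues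
  have hnn : ∀ χ i, 0 ≤ lam χ i := fun χ i => (hpsd χ).eigenvalues_nonneg i
  have hpos : (matrixOp M).IsPositive := by
    rw [hM, matrixOp_mul, ← matrixOp_adjoint]
    exact ContinuousLinearMap.isPositive_self_comp_adjoint _
  have hdet : ∀ χ, (evalMat χ M).det = ((∏ i, lam χ i : ℝ) : ℂ) := fun χ => by
    rw [(hpsd χ).isHermitian.det_eq_prod_eigenvalues]
    simp [lam]
  have htrc : Continuous fun χ : PontryaginDual Λ => (evalMat χ M).trace.re :=
    Complex.continuous_re.comp (continuous_evalMat M).matrix_trace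
  obtain ⟨c, hc⟩ := (isCompact_range htrc).bddAbove
  have he : ∀ χ i, lam χ i ∈ Set.Icc 0 c := fun χ i =>
    ⟨hnn χ i, (eigenvalues_le_re_trace (hpsd χ) i).trans (hc ⟨χ, rfl⟩)⟩
  have hpow : ∀ n : ℕ, Integrable (fun χ => ∑ i, lam χ i ^ n) (dualMeasure Λ) ∧
      (∑ i, ⟪unitVec Λ i, (matrixOp M ^ n) (unitVec Λ i)⟫_ℂ).re =
        ∫ χ, ∑ i, lam χ i ^ n ∂(dualMeasure Λ) := fun n => by
    have h1 : ∀ χ, (evalMat χ (M ^ n)).trace = ((∑ i, lam χ i ^ n : ℝ) : ℂ) := fun χ => by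
      rw [evalMat_pow, trace_pow_eq_sum_eigenvalues (hpsd χ).isHermitian]
    constructor
    · have := (integrable_of_continuous_dual (continuous_evalMat (M ^ n)).matrix_trace).re
      simpa only [h1, RCLike.re_eq_complex_re, Complex.ofReal_re] using this
    · rw [← matrixOp_pow, sum_inner_unitVec_matrixOp]
      simp only [h1]
      rw [integral_complex_ofReal, Complex.ofReal_re]
  have hshift : ∀ ε > 0, Integrable (fun χ => ∑ i, Real.log (|lam χ i| + ε)) (dualMeasure Λ) := by
    intro ε hε
    -- The sum of logarithms is log det (M(χ) + ε), a continuous function of χ since this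
    -- determinant is positive.
    have h1 : ∀ χ, ∑ i, Real.log (|lam χ i| + ε) =
        Real.log (evalMat χ M + (ε : ℂ) • (1 : Matrix I I ℂ)).det.re := fun χ => by
      rw [det_add_smul_one_eq_prod (hpsd χ).isHermitian, Complex.ofReal_re, Real.log_prod]
      · exact Finset.sum_congr rfl fun i _ => by rw [abs_of_nonneg (hnn χ i)]
      · intro i _
        have := hnn χ i
        exact (add_pos_of_nonneg_of_pos this hε).ne'
    simp only [h1]
    refine integrable_of_continuous_dual ((Complex.continuous_re.comp
      (continuous_det_add_smul_one M ε)).log fun χ => ?_)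
    simp only [Function.comp_apply]
    rw [det_add_smul_one_eq_prod (hpsd χ).isHermitian, Complex.ofReal_re]
    exact Finset.prod_ne_zero_iff.2 fun i _ => (add_pos_of_nonneg_of_pos (hnn χ i) hε).ne'
  have hne' : ∀ᵐ χ ∂(dualMeasure Λ), ∀ i, lam χ i ≠ 0 := by
    filter_upwards [hne] with χ hχ i hi
    refine hχ ?_
    rw [hdet, Finset.prod_eq_zero (Finset.mem_univ i) hi, Complex.ofReal_zero]
  have hsum : (fun χ => Real.log (evalMat χ M).det.re) =ᵐ[dualMeasure Λ]
      fun χ => ∑ i, Real.log (lam χ i) := by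
    filter_upwards [hne'] with χ hχ
    rw [hdet, Complex.ofReal_re, Real.log_prod fun i _ => hχ i]
  obtain ⟨h1, h2⟩ := integral_log_rieszMeasure hpos (norm_unitVec (Λ := Λ)) he hpow hshift hne'
    (hlog.congr hsum)
  have h1' : IntegrableOn Real.log (Set.Ioi 0) (spectralMeasure (matrixOp M)) := h1
  rw [fkDet, if_pos h1', integral_congr_ae hsum]
  exact congrArg Real.exp h2

end Determinant

/-! ### Gram determinants of pairs of complex matrices. -/

section LinearAlgebra

open scoped ComplexOrder

variable {J : Type*} [Fintype J] [DecidableEq J]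

lemma one_le_re_det_one_add_conjTranspose_mul_self (T : Matrix J J ℂ) :
    1 ≤ (1 + T.conjTranspose * T).det.re := by
  have h := Matrix.posSemidef_conjTranspose_mul_self T
  have hd := det_add_smul_one_eq_prod h.isHermitian 1
  rw [Complex.ofReal_one, one_smul, add_comm] at hd
  rw [hd, Complex.ofReal_re]
  calc (1 : ℝ) = ∏ _i : J, 1 := by simp
    _ ≤ _ := Finset.prod_le_prod (fun _ _ => zero_le_one) fun i _ => by
      linarith [h.eigenvalues_nonneg i]

/-- Factoring out the invertible P reduces the determinant of P*P + Q*Q to that of 1 + T*T with T =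
QP⁻¹. This yields both the lower bound and the symmetry of δ below. -/
lemma conjTranspose_mul_add_eq {P : Matrix J J ℂ} (Q : Matrix J J ℂ) (hP : IsUnit P.det) :
    P.conjTranspose * P + Q.conjTranspose * Q =
      P.conjTranspose * (1 + (Q * P⁻¹).conjTranspose * (Q * P⁻¹)) * P := by
  have h1 : Q * P⁻¹ * P = Q := by rw [mul_assoc, Matrix.nonsing_inv_mul P hP, mul_one]
  rw [mul_add, add_mul, mul_one]
  congr 1
  calc Q.conjTranspose * Q = (Q * P⁻¹ * P).conjTranspose * (Q * P⁻¹ * P) := by rw [h1]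
    _ = _ := by rw [Matrix.conjTranspose_mul (Q * P⁻¹) P]; simp only [mul_assoc]

lemma norm_det_sq_le_re_det {P : Matrix J J ℂ} (Q : Matrix J J ℂ) (hP : P.det ≠ 0) :
    ‖P.det‖ ^ 2 ≤ (P.conjTranspose * P + Q.conjTranspose * Q).det.re := by
  have h1 := one_le_re_det_one_add_conjTranspose_mul_self (Q * P⁻¹)
  rw [conjTranspose_mul_add_eq Q hP.isUnit, Matrix.det_mul, Matrix.det_mul,
    Matrix.det_conjTranspose, mul_right_comm]
  have h3 : star P.det * P.det = ((‖P.det‖ ^ 2 : ℝ) : ℂ) := by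
    rw [← Complex.normSq_eq_norm_sq, Complex.normSq_eq_conj_mul_self]
    rfl
  rw [h3, Complex.re_ofReal_mul]
  exact le_mul_of_one_le_right (by positivity) h1

/-- For commuting matrices `P` and `Q` with `P` invertible, `P* P + Q* Q` and `P P* + Q Q*` have
the same determinant. -/
lemma det_conjTranspose_mul_add_comm {P Q : Matrix J J ℂ} (hPQ : Commute P Q) (hP : P.det ≠ 0) :
    (P.conjTranspose * P + Q.conjTranspose * Q).det =
      (P * P.conjTranspose + Q * Q.conjTranspose).det := by
  have hu : IsUnit P.det := hP.isUnit
  have hu' : IsUnit P.conjTranspose.det := by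
    rw [Matrix.det_conjTranspose]
    exact hu.star
  have h := conjTranspose_mul_add_eq Q.conjTranspose hu'
  rw [Matrix.conjTranspose_conjTranspose, Matrix.conjTranspose_conjTranspose] at h
  -- Commutation makes P⁻¹Q and QP⁻¹ equal, so both factorizations involve the same T = QP⁻¹, once
  -- as 1 + T*T and once as 1 + TT*; these have equal determinants by Sylvester's identity.
  have hc : Q.conjTranspose * P.conjTranspose⁻¹ = (Q * P⁻¹).conjTranspose := by
    have h1 : P⁻¹ * Q = Q * P⁻¹ := by
      calc P⁻¹ * Q = P⁻¹ * Q * (P * P⁻¹) := by rw [Matrix.mul_nonsing_inv P hu, mul_one]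
        _ = P⁻¹ * (Q * P) * P⁻¹ := by simp only [mul_assoc]
        _ = P⁻¹ * P * Q * P⁻¹ := by rw [← hPQ.eq]; simp only [mul_assoc]
        _ = Q * P⁻¹ := by rw [Matrix.nonsing_inv_mul P hu, one_mul]
    rw [← h1, Matrix.conjTranspose_mul, Matrix.conjTranspose_nonsing_inv]
  rw [h, conjTranspose_mul_add_eq Q hu, hc, Matrix.conjTranspose_conjTranspose]
  simp only [Matrix.det_mul]
  rw [Matrix.det_one_add_mul_comm]
  ring

lemma det_conjTranspose_mul_add_comm_of_or {P Q : Matrix J J ℂ} (hPQ : Commute P Q)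
    (h : P.det ≠ 0 ∨ Q.det ≠ 0) :
    (P.conjTranspose * P + Q.conjTranspose * Q).det =
      (P * P.conjTranspose + Q * Q.conjTranspose).det := by
  rcases h with h | h
  · exact det_conjTranspose_mul_add_comm hPQ h
  · rw [add_comm, add_comm (P * _)]
    exact det_conjTranspose_mul_add_comm hPQ.symm h

/-- If the rows of `B` are orthogonal to those of `A*`, the Gram determinant of both families
together is the product of the two Gram determinants. -/
lemma det_conjTranspose_mul_self_fromRows {K : Type*} [Fintype K] [DecidableEq K]
    {A : Matrix (J ⊕ K) J ℂ} {B : Matrix K (J ⊕ K) ℂ} (hBA : B * A = 0) :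
    ((Matrix.fromRows A.conjTranspose B).conjTranspose *
      Matrix.fromRows A.conjTranspose B).det =
      (A.conjTranspose * A).det * (B * B.conjTranspose).det := by
  have hAB : A.conjTranspose * B.conjTranspose = 0 := by
    rw [← Matrix.conjTranspose_mul, hBA, Matrix.conjTranspose_zero]
  -- The stacked matrix N is square, so N*N may be replaced by NN*, which is block diagonal by
  -- orthogonality.
  rw [Matrix.det_mul_comm, Matrix.conjTranspose_fromRows_eq_fromCols_conjTranspose,
    Matrix.fromRows_mul_fromCols, Matrix.conjTranspose_conjTranspose, hBA, hAB,
    Matrix.det_fromBlocks_zero₂₁]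

end LinearAlgebra

/-! ### Haar measure on the circle and logarithms of polynomials. -/

section CirclePushforward

open Filter Topology

instance fact_zero_lt_two_pi : Fact (0 < 2 * Real.pi) := ⟨Real.two_pi_pos⟩

lemma integral_fourier_haarAddCircle {T : ℝ} [Fact (0 < T)] {n : ℤ} (hn : n ≠ 0) :
    ∫ t : AddCircle T, fourier n t ∂AddCircle.haarAddCircle = 0 := by
  have h := orthonormal_iff_ite.1 (orthonormal_fourier (T := T)) 0 n
  rw [if_neg hn.symm, fourierLp, fourierLp,
    ContinuousMap.inner_toLp AddCircle.haarAddCircle (fourier 0) (fourier n)] at h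
  simpa using h

/-- A probability measure on the circle all of whose nonconstant Fourier coefficients vanish is
the Haar measure. -/
lemma eq_haarAddCircle_of_integral_fourier {T : ℝ} [Fact (0 < T)] {μ : Measure (AddCircle T)}
    [IsProbabilityMeasure μ] (h : ∀ n : ℤ, n ≠ 0 → ∫ t, fourier n t ∂μ = 0) :
    μ = AddCircle.haarAddCircle := by
  have hL : ∀ (μ : Measure (AddCircle T)) [IsProbabilityMeasure μ],
      ∃ φ : C(AddCircle T, ℂ) →L[ℂ] ℂ, ∀ f, φ f = ∫ t, f t ∂μ := fun μ _ => by
    have hi : ∀ f : C(AddCircle T, ℂ), Integrable f μ := fun f =>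
      f.continuous.integrable_of_hasCompactSupport (HasCompactSupport.of_compactSpace f)
    refine ⟨LinearMap.mkContinuous
      { toFun := fun f => ∫ t, f t ∂μ
        map_add' := fun f g => integral_add (hi f) (hi g)
        map_smul' := fun c f => integral_const_mul c f } 1 fun f => ?_, fun f => rfl⟩
    have := norm_integral_le_of_norm_le_const (μ := μ)
      (Eventually.of_forall fun t => f.norm_coe_le_norm t)
    simpa using this
  obtain ⟨φ, hφ⟩ := hL μ
  obtain ⟨ψ, hψ⟩ := hL AddCircle.haarAddCircle
  -- Both functionals are continuous and agree on the characters, whose span is dense.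
  have hφψ : φ = ψ := by
    refine ContinuousLinearMap.ext_on (s := Set.range (fourier (T := T)))
      (Submodule.dense_iff_topologicalClosure_eq_top.2 span_fourier_closure_eq_top) ?_
    rintro _ ⟨n, rfl⟩
    rw [hφ, hψ]
    by_cases hn : n = 0
    · subst hn; simp
    · rw [h n hn, integral_fourier_haarAddCircle hn]
  refine ext_of_forall_integral_eq_of_IsFiniteMeasure fun f => ?_
  let g : C(AddCircle T, ℂ) := ⟨fun t => (f t : ℂ), by fun_prop⟩
  have hg : φ g = ψ g := by rw [hφψ]
  rw [hφ, hψ] at hg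
  simp only [g, ContinuousMap.coe_mk] at hg
  rw [integral_complex_ofReal, integral_complex_ofReal] at hg
  exact_mod_cast hg

lemma volume_singleton_addCircle {T : ℝ} [Fact (0 < T)] (a : AddCircle T) :
    volume ({a} : Set (AddCircle T)) = 0 := by
  rw [← Metric.closedBall_zero, AddCircle.volume_closedBall]
  have : (0 : ℝ) < T := Fact.out
  simp [this.le]

/-- Zeros of p on the circle give only logarithmic singularities. For p = 0 the integrand is 0
because `Real.log 0 = 0`. -/
lemma integrable_log_norm_eval_toCircle (p : Polynomial ℂ) :
    Integrable (fun t : AddCircle (2 * Real.pi) => Real.log ‖p.eval (t.toCircle : ℂ)‖)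
      AddCircle.haarAddCircle := by
  have hm : Measurable fun t : AddCircle (2 * Real.pi) =>
      Real.log ‖p.eval (t.toCircle : ℂ)‖ := by
    refine Real.measurable_log.comp (Continuous.measurable ?_)
    have := AddCircle.continuous_toCircle (T := 2 * Real.pi)
    fun_prop
  have hv : Integrable (fun t : AddCircle (2 * Real.pi) => Real.log ‖p.eval (t.toCircle : ℂ)‖)
      volume := by
    rw [← (AddCircle.measurePreserving_mk (2 * Real.pi) 0).map_eq,
      integrable_map_measure hm.aestronglyMeasurable
        (AddCircle.measurePreserving_mk _ 0).measurable.aemeasurable,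
      zero_add, ← IntegrableOn,
      ← intervalIntegrable_iff_integrableOn_Ioc_of_le Real.two_pi_pos.le]
    have h : CircleIntegrable (fun z => Real.log ‖p.eval z‖) 0 1 := by
      have := ((analyticOnNhd_id.aeval_polynomial p).meromorphicOn
        (U := Metric.sphere (0 : ℂ) |1|)).circleIntegrable_log_norm
      simpa using this
    refine h.congr ?_
    intro θ _
    simp [circleMap, AddCircle.toCircle_apply_mk, Circle.coe_exp]
  rw [AddCircle.volume_eq_smul_haarAddCircle] at hv
  exact (integrable_smul_measure (by simpa using Real.pi_pos) ENNReal.ofReal_ne_top).1 hv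

end CirclePushforward

/-! ### Equidistribution of χ(x) for x of infinite order. -/

section InfiniteOrder

variable {Λ : Type u} [CommGroup Λ] [TopologicalSpace Λ] {x : Λ}

/-- The angle of the value of a character at `x`. -/
def dualAngle (x : Λ) (χ : PontryaginDual Λ) : AddCircle (2 * Real.pi) :=
  AddCircle.homeomorphCircle'.symm (χ x)

lemma toCircle_dualAngle (x : Λ) (χ : PontryaginDual Λ) : (dualAngle x χ).toCircle = χ x := by
  have h : AddCircle.homeomorphCircle' (dualAngle x χ) = χ x :=
    AddCircle.homeomorphCircle'.apply_symm_apply (χ x)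
  rw [← h]
  induction dualAngle x χ using QuotientAddGroup.induction_on with
  | H t =>
    rw [AddCircle.toCircle_apply_mk, AddCircle.homeomorphCircle'_apply_mk,
      div_self Real.two_pi_pos.ne', one_mul]

lemma continuous_dualAngle (x : Λ) : Continuous (dualAngle x) :=
  AddCircle.homeomorphCircle'.symm.continuous.comp (continuous_dual_apply x)

variable [DiscreteTopology Λ]

/-- If `x` has infinite order, the values at `x` of the characters are equidistributed. -/
lemma measurePreserving_dualAngle (hx : ¬ IsOfFinOrder x) :
    MeasurePreserving (dualAngle x) (dualMeasure Λ) AddCircle.haarAddCircle := by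
  have hm := (continuous_dualAngle x).measurable
  refine ⟨hm, ?_⟩
  have : IsProbabilityMeasure ((dualMeasure Λ).map (dualAngle x)) :=
    Measure.isProbabilityMeasure_map hm.aemeasurable
  refine eq_haarAddCircle_of_integral_fourier fun n hn => ?_
  rw [integral_map hm.aemeasurable (ContinuousMap.continuous _).aestronglyMeasurable]
  -- The n-th Fourier coefficient of the pushforward is the integral of χ(xⁿ), which vanishes
  -- because xⁿ ≠ 1 for n ≠ 0.
  have h : ∀ χ : PontryaginDual Λ, fourier n (dualAngle x χ) = ((χ (x ^ n) : Circle) : ℂ) :=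
    fun χ => by rw [fourier_apply, AddCircle.toCircle_zsmul, toCircle_dualAngle, map_zpow]
  simp only [h]
  refine integral_dual_apply_of_ne_one fun h1 => hx ?_
  exact isOfFinOrder_iff_zpow_eq_one.2 ⟨n, hn, h1⟩

lemma integrable_log_norm_eval_dual (hx : ¬ IsOfFinOrder x) (p : Polynomial ℂ) :
    Integrable (fun χ : PontryaginDual Λ => Real.log ‖p.eval (χ x : ℂ)‖) (dualMeasure Λ) := by
  have := (measurePreserving_dualAngle hx).integrable_comp_of_integrable
    (integrable_log_norm_eval_toCircle p)
  simpa only [Function.comp_def, toCircle_dualAngle] using this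

lemma ae_eval_dual_ne_zero (hx : ¬ IsOfFinOrder x) {p : Polynomial ℂ} (hp : p ≠ 0) :
    ∀ᵐ χ ∂(dualMeasure Λ), p.eval (χ x : ℂ) ≠ 0 := by
  -- Points of the circle are Haar-null, so χ(x) almost surely avoids any given r, hence the
  -- finitely many roots of p.
  have h : ∀ r : ℂ, ∀ᵐ χ ∂(dualMeasure Λ), (χ x : ℂ) ≠ r := fun r => by
    by_cases hr : ∃ z : Circle, (z : ℂ) = r
    · obtain ⟨z, rfl⟩ := hr
      have h0 : AddCircle.haarAddCircle
          ({AddCircle.homeomorphCircle'.symm z} : Set (AddCircle (2 * Real.pi))) = 0 := by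
        have := volume_singleton_addCircle (AddCircle.homeomorphCircle'.symm z)
        rw [AddCircle.volume_eq_smul_haarAddCircle] at this
        simpa [Real.pi_pos.not_ge] using this
      rw [← (measurePreserving_dualAngle hx).measure_preimage
        (measurableSet_singleton _).nullMeasurableSet] at h0
      filter_upwards [measure_eq_zero_iff_ae_notMem.1 h0] with χ hχ hz
      refine hχ ?_
      have : χ x = z := Circle.ext hz
      simp [dualAngle, this]
    · exact Filter.Eventually.of_forall fun χ h => hr ⟨_, h⟩
  have h' : ∀ᵐ χ ∂(dualMeasure Λ), ∀ r ∈ p.roots.toFinset, (χ x : ℂ) ≠ r :=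
    (Finset.eventually_all _).2 fun r _ => h r
  filter_upwards [h'] with χ hχ h0
  exact hχ (χ x) (by simpa [hp] using h0) rfl

end InfiniteOrder

/-! ### Injectivity of group ring elements on ℓ²(Λ). -/

section Injective

open Filter Topology

variable {Λ : Type u} [CommGroup Λ]

/-- An eigenvector of the shift is geometric along each infinite orbit of x, so in one of the two
directions its absolute value does not decrease; square summability then forces it to vanish. -/
lemma rightShift_injective_sub_smul {x : Λ} (hx : ¬ IsOfFinOrder x) (r : ℂ) {f : EllTwo Λ}
    (hf : rightShift x f = r • f) : f = 0 := by
  have hstep : ∀ g, f (g * x⁻¹) = r * f g := fun g => by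
    have := congrArg (fun h : EllTwo Λ => h g) hf
    simpa [rightShift_apply] using this
  have hneg : ∀ (n : ℕ) g, f (g * (x ^ n)⁻¹) = r ^ n * f g := fun n => by
    induction n with
    | zero => simp
    | succ n ih =>
      intro g
      rw [pow_succ, mul_inv, mul_comm (x ^ n)⁻¹, ← mul_assoc, ih, hstep]
      ring
  have hinj : Function.Injective fun n : ℕ => x ^ n := injective_pow_iff_not_isOfFinOrder.2 hx
  have htend : ∀ s : ℕ → Λ, Function.Injective s → Tendsto (fun n => ‖f (s n)‖ ^ 2) atTop (𝓝 0) :=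
    fun s hs => by
      have h := (memℓp_gen_iff (E := fun _ : Λ => ℂ) (p := 2) (by norm_num)).1 (lp.memℓp f)
      have := (h.comp_injective hs).tendsto_atTop_zero
      simpa [Function.comp_def] using this
  have hzero : ∀ (g : Λ) (s : ℕ → Λ), Function.Injective s → (∀ n, ‖f g‖ ≤ ‖f (s n)‖) → f g = 0 := by
    intro g s hs hle
    have h := ge_of_tendsto' (htend s hs) fun n =>
      pow_le_pow_left₀ (norm_nonneg (f g)) (hle n) 2
    have h0 : ‖f g‖ ^ 2 = 0 := le_antisymm h (by positivity)
    simpa using h0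
  ext g
  -- For |r| ≥ 1 the values grow weakly along g x⁻ⁿ, for |r| ≤ 1 along g xⁿ.
  rcases le_total 1 ‖r‖ with h1 | h1
  · refine hzero g (fun n => g * (x ^ n)⁻¹) (fun m n hmn => hinj (by simpa using hmn)) fun n => ?_
    rw [hneg, norm_mul, norm_pow]
    exact le_mul_of_one_le_left (norm_nonneg _) (one_le_pow₀ h1)
  · refine hzero g (fun n => g * x ^ n) (fun m n hmn => hinj (by simpa using hmn)) fun n => ?_
    have h := hneg n (g * x ^ n)
    rw [mul_inv_cancel_right] at h
    rw [h, norm_mul, norm_pow]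
    exact mul_le_of_le_one_left (norm_nonneg _) (pow_le_one₀ (norm_nonneg r) h1)

lemma rightMul_injective_mul {a b : MonoidAlgebra ℂ Λ} (ha : Function.Injective (rightMul a))
    (hb : Function.Injective (rightMul b)) : Function.Injective (rightMul (a * b)) := by
  rw [rightMul_mul]
  exact ha.comp hb

lemma rightMul_injective_of_isUnit {a : MonoidAlgebra ℂ Λ} (ha : IsUnit a) :
    Function.Injective (rightMul a) := by
  obtain ⟨b, hb⟩ := ha.exists_left_inv
  refine Function.LeftInverse.injective (g := rightMul b) fun f => ?_
  rw [← rightMul_apply_mul, hb, rightMul_one]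
  rfl

/-- A nonzero polynomial in an element of infinite order acts injectively on `ℓ²(Λ)`. -/
lemma rightMul_injective_aeval {x : Λ} (hx : ¬ IsOfFinOrder x) {q : Polynomial ℂ}
    (hq : q.Monic) :
    Function.Injective (rightMul (Polynomial.aeval (MonoidAlgebra.single x (1 : ℂ)) q)) := by
  -- Over ℂ the polynomial is a product of linear factors, and each x − r acts injectively.
  rw [(IsAlgClosed.splits q).eq_prod_roots_of_monic hq, map_multiset_prod, Multiset.map_map]
  refine Multiset.induction_on q.roots ?_ fun r s ih => ?_
  · simp only [Multiset.map_zero, Multiset.prod_zero, rightMul_one]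
    exact Function.injective_id
  · rw [Multiset.map_cons, Multiset.prod_cons]
    refine rightMul_injective_mul ?_ ih
    refine (injective_iff_map_eq_zero _).2 fun f hf => rightShift_injective_sub_smul hx r ?_
    have h : rightMul ((⇑(Polynomial.aeval (MonoidAlgebra.single x (1 : ℂ))) ∘
        fun a => Polynomial.X - Polynomial.C a) r) f = rightShift x f - r • f := by
      have h1 : (⇑(Polynomial.aeval (MonoidAlgebra.single x (1 : ℂ))) ∘
          fun a => Polynomial.X - Polynomial.C a) r =
          MonoidAlgebra.single x (1 : ℂ) + MonoidAlgebra.single 1 (-r) := by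
        simp [sub_eq_add_neg, MonoidAlgebra.single_neg]
      rw [h1, rightMul_add, rightMul_single, rightMul_single]
      have h2 : rightShift (1 : Λ) f = f := by
        ext g
        simp [rightShift_apply]
      simp [h2, sub_eq_add_neg]
    exact sub_eq_zero.1 (h.symm.trans hf)

/-- Multiplication by a is normal because ℂΛ is commutative, so a and its adjoint have the same
kernel. -/
lemma rightMul_injective_star {a : MonoidAlgebra ℂ Λ} (ha : Function.Injective (rightMul a)) :
    Function.Injective (rightMul (star a)) := by
  refine (injective_iff_map_eq_zero _).2 fun f hf => (injective_iff_map_eq_zero _).1 ha f ?_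
  rw [← inner_self_eq_zero (𝕜 := ℂ), inner_rightMul_left, ← rightMul_apply_mul, mul_comm,
    rightMul_apply_mul, hf, map_zero, inner_zero_right]

end Injective

/-! ### Acyclicity from a homotopy up to an injective factor. -/

section Acyclic

variable {Λ : Type u} [CommGroup Λ] {I : Type v} [Fintype I] [DecidableEq I]

lemma matrixOp_smul_one_apply (p : MonoidAlgebra ℂ Λ) (x : FreeHilbert Λ I) (i : I) :
    matrixOp (p • (1 : Matrix I I (MonoidAlgebra ℂ Λ))) x i = rightMul p (x i) := by
  rw [matrixOp_apply, Finset.sum_eq_single i]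
  · simp
  · intro k _ hk
    simp [Matrix.one_apply_ne hk, rightMul_zero]
  · simp

lemma matrixOp_smul_one_injective {p : MonoidAlgebra ℂ Λ} (hp : Function.Injective (rightMul p)) :
    Function.Injective (matrixOp (p • (1 : Matrix I I (MonoidAlgebra ℂ Λ)))) := by
  intro x y hxy
  ext i : 1
  have := congrArg (fun z : FreeHilbert Λ I => z i) hxy
  simp only [matrixOp_smul_one_apply] at this
  exact hp this

lemma matrixOp_smul_one_comm {K : Type w} [Fintype K] [DecidableEq K] (p : MonoidAlgebra ℂ Λ)
    (A : Matrix I K (MonoidAlgebra ℂ Λ)) (x : FreeHilbert Λ I) :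
    matrixOp (p • (1 : Matrix K K (MonoidAlgebra ℂ Λ))) (matrixOp A x) =
      matrixOp A (matrixOp (p • (1 : Matrix I I (MonoidAlgebra ℂ Λ))) x) := by
  rw [← ContinuousLinearMap.comp_apply, ← ContinuousLinearMap.comp_apply, ← matrixOp_mul,
    ← matrixOp_mul]
  simp

open Classical in
/-- A complex of length two whose identity becomes null-homotopic after multiplication by an
element of the group ring that acts injectively on `ℓ²(Λ)` is `L²`-acyclic. -/
theorem BasedComplex.isL2Acyclic_of_homotopy (C : BasedComplex.{u, v} Λ) (hdim : C.dim = 2)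
    {p : MonoidAlgebra ℂ Λ} (hp : Function.Injective (rightMul p))
    (S₀ : Matrix (C.ι 0) (C.ι 1) (MonoidAlgebra ℂ Λ))
    (S₁ : Matrix (C.ι 1) (C.ι 2) (MonoidAlgebra ℂ Λ))
    (h₀ : S₀ * C.d 0 = p • 1) (h₁ : C.d 0 * S₀ + S₁ * C.d 1 = p • 1) (h₂ : C.d 1 * S₁ = p • 1) :
    C.IsL2Acyclic := by
  have hempty : ∀ n, IsEmpty (C.ι (n + 3)) := fun n => C.isEmpty _ (by omega)
  have hle : ∀ n, (C.bd (n + 1)).range.topologicalClosure ≤ (C.bd n).ker := fun n => by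
    refine Submodule.topologicalClosure_minimal _ ?_ (C.bd n).isClosed_ker
    rintro _ ⟨x, rfl⟩
    change C.bd n (C.bd (n + 1) x) = 0
    rw [bd, bd, ← ContinuousLinearMap.comp_apply, ← matrixOp_mul, C.d_mul_d, matrixOp_zero]
    rfl
  refine ⟨?_, fun n => le_antisymm (hle n) ?_⟩
  · rw [Submodule.topologicalClosure_eq_top_iff, Submodule.eq_bot_iff]
    intro y hy
    -- The orthogonal complement of the image is the kernel of the adjoint; the adjoint of h₀ shows
    -- that the element `star p` annihilates it.
    have hy' : (C.bd 0).adjoint y = 0 := by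
      rw [ContinuousLinearMap.orthogonal_range] at hy
      exact hy
    rw [bd, matrixOp_adjoint] at hy'
    have h : matrixOp (star p • (1 : Matrix (C.ι 0) (C.ι 0) (MonoidAlgebra ℂ Λ))) y = 0 := by
      have h' := congrArg Matrix.conjTranspose h₀
      rw [Matrix.conjTranspose_mul, Matrix.conjTranspose_smul, Matrix.conjTranspose_one] at h'
      rw [← h', matrixOp_mul, ContinuousLinearMap.comp_apply, hy', map_zero]
    exact matrixOp_smul_one_injective (rightMul_injective_star hp) (h.trans (map_zero _).symm)
  · match n with
    | 0 =>
      intro x hx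
      have hcpl : CompleteSpace (C.bd 1).range.topologicalClosure :=
        (Submodule.isClosed_topologicalClosure _).completeSpace_coe
      -- The component z orthogonal to the closed image is harmonic: it is killed by the boundary
      -- and by the adjoint of the incoming one.
      obtain ⟨y, hy, z, hz, rfl⟩ :=
        (C.bd 1).range.topologicalClosure.exists_add_mem_mem_orthogonal x
      have hz0 : matrixOp (C.d 0) z = 0 := by
        have h : (y + z) - y ∈ (C.bd 0).ker := Submodule.sub_mem _ hx (hle 0 hy)
        rw [add_sub_cancel_left] at h
        exact h
      have hz1 : matrixOp (C.d 1).conjTranspose z = 0 := by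
        rw [Submodule.orthogonal_closure, ContinuousLinearMap.orthogonal_range, bd,
          matrixOp_adjoint] at hz
        exact hz
      set u := matrixOp (p • (1 : Matrix (C.ι 1) (C.ι 1) (MonoidAlgebra ℂ Λ))) z with hu
      have hu0 : matrixOp (C.d 1).conjTranspose u = 0 := by
        rw [hu, ← matrixOp_smul_one_comm, hz1, map_zero]
      have hu1 : u = matrixOp (C.d 1) (matrixOp S₁ z) := by
        rw [hu, ← h₁, matrixOp_add, matrixOp_mul, matrixOp_mul, add_apply,
          ContinuousLinearMap.comp_apply, ContinuousLinearMap.comp_apply, hz0, map_zero, zero_add]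
      -- The vector u = p z lies both in the image of the incoming boundary, by the homotopy, and in
      -- the kernel of its adjoint, so it is orthogonal to itself.
      have hu2 : u = 0 := by
        rw [← inner_self_eq_zero (𝕜 := ℂ)]
        nth_rewrite 1 [hu1]
        rw [← ContinuousLinearMap.adjoint_inner_right, matrixOp_adjoint, hu0, inner_zero_right]
      rw [matrixOp_smul_one_injective hp (hu2.trans (map_zero _).symm), add_zero]
      exact hy
    | 1 =>
      intro x hx
      have hx' : matrixOp (C.d 1) x = 0 := hx
      have h : matrixOp (p • (1 : Matrix (C.ι 2) (C.ι 2) (MonoidAlgebra ℂ Λ))) x = 0 := by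
        rw [← h₂, matrixOp_mul, ContinuousLinearMap.comp_apply, hx', map_zero]
      rw [matrixOp_smul_one_injective hp (h.trans (map_zero _).symm)]
      exact zero_mem _
    | n + 2 =>
      intro x _
      have := hempty n
      rw [Subsingleton.elim x 0]
      exact zero_mem _

end Acyclic

/-! ### The Koszul complex of two commuting matrices and its homotopies. -/

section Koszul

variable {R J : Type*} [CommRing R] [Fintype J] [DecidableEq J] {P Q U V : Matrix J J R}

/-- The adjugates of P and Q commute since adjugation is antimultiplicative; multiplying by Q on
both sides trades adj Q for det Q, which can be cancelled. -/
lemma commute_adjugate_of_isRegular_det (hPQ : Commute P Q) (hQ : IsLeftRegular Q.det) :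
    Commute P.adjugate Q := by
  have h : Q.adjugate * P.adjugate = P.adjugate * Q.adjugate := by
    rw [← Matrix.adjugate_mul_distrib, ← Matrix.adjugate_mul_distrib, hPQ.eq]
  have h' : Q.det • (P.adjugate * Q) = Q.det • (Q * P.adjugate) := by
    calc Q.det • (P.adjugate * Q) = Q * (Q.adjugate * P.adjugate) * Q := by
          rw [← mul_assoc, Matrix.mul_adjugate, smul_mul_assoc, one_mul, smul_mul_assoc]
      _ = Q.det • (Q * P.adjugate) := by
          rw [h, mul_assoc, mul_assoc, Matrix.adjugate_mul, mul_smul_comm, mul_one, mul_smul_comm]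
  ext i j
  exact hQ (congrFun (congrFun h' i) j)

/-- The adjugate of a matrix commutes with everything the matrix commutes with. -/
lemma commute_adjugate (hPQ : Commute P Q) : Commute P.adjugate Q := by
  -- Passing from Q to X + Q over R[X] makes the determinant a monic, hence regular, polynomial; the
  -- scalar X is subtracted again afterwards.
  let M : Matrix J J (Polynomial R) := Matrix.scalar J Polynomial.X + Q.map Polynomial.C
  have hM : M.det = (-Q).charpoly := by
    rw [Matrix.charpoly, Matrix.charmatrix]
    congr 1
    ext i j
    simp [M]
  have hc : Commute (P.map Polynomial.C) M := by
    refine ((Matrix.scalar_commute _ (fun _ => Commute.all _ _) _).symm).add_right ?_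
    rw [Commute, SemiconjBy, ← Matrix.map_mul, ← Matrix.map_mul, hPQ.eq]
  have h := commute_adjugate_of_isRegular_det hc
    (by rw [hM]; exact (Matrix.charpoly_monic _).isRegular.left)
  have h' : Commute (P.map Polynomial.C).adjugate (Q.map Polynomial.C) := by
    have := h.sub_right ((Matrix.scalar_commute (Polynomial.X : Polynomial R)
      (fun _ => Commute.all _ _) (P.map Polynomial.C).adjugate).symm)
    simpa [M] using this
  have hmap : (P.map Polynomial.C).adjugate = P.adjugate.map Polynomial.C :=
    (RingHom.map_adjugate Polynomial.C P).symm
  rw [hmap, Commute, SemiconjBy, ← Matrix.map_mul, ← Matrix.map_mul] at h'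
  exact Matrix.map_injective Polynomial.C_injective h'

/-- Homotopies contracting the Koszul complex of `P` and `Q` up to `det P`. -/
lemma koszul_homotopy_left (hPQ : Commute P Q) (hUV : U * V = 1) :
    Matrix.fromCols P.adjugate (0 : Matrix J J R) * Matrix.fromRows P Q = P.det • 1 ∧
    Matrix.fromRows P Q * Matrix.fromCols P.adjugate (0 : Matrix J J R) +
      Matrix.fromRows (0 : Matrix J J R) (P.adjugate * V) * Matrix.fromCols (-(U * Q)) (U * P) =
        P.det • 1 ∧
    Matrix.fromCols (-(U * Q)) (U * P) * Matrix.fromRows (0 : Matrix J J R) (P.adjugate * V) =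
      P.det • 1 := by
  have hVU : V * U = 1 := mul_eq_one_comm.1 hUV
  have h1 : P.adjugate * V * (U * Q) = Q * P.adjugate := by
    rw [mul_assoc, ← mul_assoc V, hVU, one_mul, (commute_adjugate hPQ).eq]
  have h2 : P.adjugate * V * (U * P) = P.det • 1 := by
    rw [mul_assoc, ← mul_assoc V, hVU, one_mul, Matrix.adjugate_mul]
  have h3 : U * P * (P.adjugate * V) = P.det • 1 := by
    rw [mul_assoc, ← mul_assoc P, Matrix.mul_adjugate, smul_mul_assoc, one_mul, mul_smul_comm, hUV]
  refine ⟨?_, ?_, ?_⟩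
  · rw [Matrix.fromCols_mul_fromRows, zero_mul, add_zero, Matrix.adjugate_mul]
  · rw [Matrix.fromRows_mul_fromCols, Matrix.fromRows_mul_fromCols, Matrix.fromBlocks_add,
      ← Matrix.fromBlocks_one, Matrix.fromBlocks_smul, Matrix.mul_adjugate]
    simp only [mul_neg, h1, h2]
    simp
  · rw [Matrix.fromCols_mul_fromRows, mul_zero, zero_add, h3]

/-- Homotopies contracting the Koszul complex of `P` and `Q` up to `det Q`. -/
lemma koszul_homotopy_right (hPQ : Commute P Q) (hUV : U * V = 1) :
    Matrix.fromCols (0 : Matrix J J R) Q.adjugate * Matrix.fromRows P Q = Q.det • 1 ∧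
    Matrix.fromRows P Q * Matrix.fromCols (0 : Matrix J J R) Q.adjugate +
      Matrix.fromRows (-(Q.adjugate * V)) (0 : Matrix J J R) * Matrix.fromCols (-(U * Q)) (U * P) =
        Q.det • 1 ∧
    Matrix.fromCols (-(U * Q)) (U * P) * Matrix.fromRows (-(Q.adjugate * V)) (0 : Matrix J J R) =
      Q.det • 1 := by
  have hVU : V * U = 1 := mul_eq_one_comm.1 hUV
  have h1 : Q.adjugate * V * (U * P) = P * Q.adjugate := by
    rw [mul_assoc, ← mul_assoc V, hVU, one_mul, (commute_adjugate hPQ.symm).eq]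
  have h2 : Q.adjugate * V * (U * Q) = Q.det • 1 := by
    rw [mul_assoc, ← mul_assoc V, hVU, one_mul, Matrix.adjugate_mul]
  have h3 : U * Q * (Q.adjugate * V) = Q.det • 1 := by
    rw [mul_assoc, ← mul_assoc Q, Matrix.mul_adjugate, smul_mul_assoc, one_mul, mul_smul_comm, hUV]
  refine ⟨?_, ?_, ?_⟩
  · rw [Matrix.fromCols_mul_fromRows, zero_mul, zero_add, Matrix.adjugate_mul]
  · rw [Matrix.fromRows_mul_fromCols, Matrix.fromRows_mul_fromCols, Matrix.fromBlocks_add,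
      ← Matrix.fromBlocks_one, Matrix.fromBlocks_smul, Matrix.mul_adjugate]
    simp only [neg_mul, mul_neg, h1, h2]
    simp
  · rw [Matrix.fromCols_mul_fromRows, mul_zero, add_zero, neg_mul_neg, h3]

end Koszul

/-! ### Laplace determinants of the Koszul complex at a single character. -/

section KoszulEval

open scoped ComplexOrder

variable {J : Type*} [Fintype J] [DecidableEq J] {P Q U : Matrix J J ℂ}

/-- The left side is the determinant of U(PP* + QQ*)U*; U contributes |det U|² = 1, and commutation
allows PP* + QQ* to be replaced by P*P + Q*Q. -/
lemma det_koszul_two (hPQ : Commute P Q) (hU : ‖U.det‖ = 1) (h : P.det ≠ 0 ∨ Q.det ≠ 0) :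
    (Matrix.fromCols (-(U * Q)) (U * P) *
      (Matrix.fromCols (-(U * Q)) (U * P)).conjTranspose).det =
      ((Matrix.fromRows P Q).conjTranspose * Matrix.fromRows P Q).det := by
  have hs : U.det * star U.det = 1 := by
    have := Complex.mul_conj U.det
    rw [Complex.normSq_eq_norm_sq, hU] at this
    simpa using this
  have h1 : Matrix.fromCols (-(U * Q)) (U * P) *
      (Matrix.fromCols (-(U * Q)) (U * P)).conjTranspose =
      U * (P * P.conjTranspose + Q * Q.conjTranspose) * U.conjTranspose := by
    rw [Matrix.conjTranspose_fromCols_eq_fromRows_conjTranspose, Matrix.fromCols_mul_fromRows,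
      Matrix.conjTranspose_neg, neg_mul_neg, Matrix.conjTranspose_mul, Matrix.conjTranspose_mul,
      add_comm]
    noncomm_ring
  have h2 : (Matrix.fromRows P Q).conjTranspose * Matrix.fromRows P Q =
      P.conjTranspose * P + Q.conjTranspose * Q := by
    rw [Matrix.conjTranspose_fromRows_eq_fromCols_conjTranspose, Matrix.fromCols_mul_fromRows]
  rw [h1, h2, det_conjTranspose_mul_add_comm_of_or hPQ h, Matrix.det_mul, Matrix.det_mul,
    Matrix.det_conjTranspose, mul_right_comm, hs, one_mul]

/-- The two boundary maps compose to zero, so the Gram determinant in the middle degree splits into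
those of the outer degrees, both equal to δ. -/
lemma det_koszul_one (hPQ : Commute P Q) (hU : ‖U.det‖ = 1) (h : P.det ≠ 0 ∨ Q.det ≠ 0) :
    (Matrix.fromRows P Q * (Matrix.fromRows P Q).conjTranspose +
      (Matrix.fromCols (-(U * Q)) (U * P)).conjTranspose *
        Matrix.fromCols (-(U * Q)) (U * P)).det =
      ((Matrix.fromRows P Q).conjTranspose * Matrix.fromRows P Q).det ^ 2 := by
  have h0 : Matrix.fromCols (-(U * Q)) (U * P) * Matrix.fromRows P Q = 0 := by
    rw [Matrix.fromCols_mul_fromRows, mul_assoc, hPQ.eq]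
    noncomm_ring
  have h1 := det_conjTranspose_mul_self_fromRows h0
  rw [det_koszul_two hPQ hU h, Matrix.conjTranspose_fromRows_eq_fromCols_conjTranspose,
    Matrix.fromCols_mul_fromRows, Matrix.conjTranspose_conjTranspose, ← pow_two] at h1
  exact h1

lemma re_det_koszul_zero (P Q : Matrix J J ℂ) :
    ((Matrix.fromRows P Q).conjTranspose * Matrix.fromRows P Q).det =
      (((Matrix.fromRows P Q).conjTranspose * Matrix.fromRows P Q).det.re : ℂ) := by
  have h := (Matrix.posSemidef_conjTranspose_mul_self (Matrix.fromRows P Q)).det_nonneg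
  exact Complex.ext rfl (by simpa using (Complex.nonneg_iff.1 h).2.symm)

lemma norm_det_sq_le_re_det_koszul (h : P.det ≠ 0) :
    ‖P.det‖ ^ 2 ≤ ((Matrix.fromRows P Q).conjTranspose * Matrix.fromRows P Q).det.re := by
  rw [Matrix.conjTranspose_fromRows_eq_fromCols_conjTranspose, Matrix.fromCols_mul_fromRows]
  exact norm_det_sq_le_re_det Q h

lemma norm_det_sq_le_re_det_koszul' (h : Q.det ≠ 0) :
    ‖Q.det‖ ^ 2 ≤ ((Matrix.fromRows P Q).conjTranspose * Matrix.fromRows P Q).det.re := by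
  rw [Matrix.conjTranspose_fromRows_eq_fromCols_conjTranspose, Matrix.fromCols_mul_fromRows,
    add_comm]
  exact norm_det_sq_le_re_det P h

end KoszulEval

/-! ### Laplacians as operators of the form N*N over the group ring. -/

section Laplacian

variable {Λ : Type u} [CommGroup Λ] (C : BasedComplex.{u, v} Λ)

lemma BasedComplex.laplacian_zero_eq :
    C.laplacian 0 = matrixOp ((C.d 0).conjTranspose * C.d 0) := by
  rw [laplacian, bd, matrixOp_adjoint, matrixOp_mul]

/-- Stacking the adjoint of one boundary matrix on the next one puts the Laplacian in the single
form N*N to which the determinant formula applies. -/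
lemma BasedComplex.laplacian_succ_eq (n : ℕ) :
    C.laplacian (n + 1) = matrixOp ((Matrix.fromRows (C.d n).conjTranspose
      (C.d (n + 1))).conjTranspose * Matrix.fromRows (C.d n).conjTranspose (C.d (n + 1))) := by
  rw [laplacian, bd, bd, matrixOp_adjoint, matrixOp_adjoint, ← matrixOp_mul, ← matrixOp_mul,
    ← matrixOp_add, Matrix.conjTranspose_fromRows_eq_fromCols_conjTranspose,
    Matrix.fromCols_mul_fromRows, Matrix.conjTranspose_conjTranspose]
  exact congrArg matrixOp (add_comm _ _)

end Laplacian

lemma submatrix_smul_one {R K L : Type*} [CommRing R] [DecidableEq K] [DecidableEq L] (e : K ≃ L)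
    (p : R) : (p • (1 : Matrix L L R)).submatrix e e = p • 1 := by
  ext i j
  simp [Matrix.one_apply]

/-! ### L²-acyclicity of Koszul complexes. -/

section KoszulAcyclic

variable {Λ : Type u} [CommGroup Λ] {J : Type w} [Fintype J] [DecidableEq J]
  {P Q U V : Matrix J J (MonoidAlgebra ℂ Λ)}

open Classical in
lemma BasedComplex.isL2Acyclic_of_koszul (C : BasedComplex.{u, v} Λ) (hdim : C.dim = 2)
    (e₀ : C.ι 0 ≃ J) (e₁ : C.ι 1 ≃ J ⊕ J) (e₂ : C.ι 2 ≃ J)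
    (hd₀ : C.d 0 = (Matrix.fromRows P Q).submatrix e₁ e₀)
    (hd₁ : C.d 1 = (Matrix.fromCols (-(U * Q)) (U * P)).submatrix e₂ e₁)
    (hPQ : Commute P Q) (hUV : U * V = 1)
    (hreg : Function.Injective (rightMul P.det) ∨ Function.Injective (rightMul Q.det)) :
    C.IsL2Acyclic := by
  have key : ∀ (p : MonoidAlgebra ℂ Λ) (S₀ : Matrix J (J ⊕ J) (MonoidAlgebra ℂ Λ))
      (S₁ : Matrix (J ⊕ J) J (MonoidAlgebra ℂ Λ)), Function.Injective (rightMul p) →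
      S₀ * Matrix.fromRows P Q = p • 1 ∧
      Matrix.fromRows P Q * S₀ + S₁ * Matrix.fromCols (-(U * Q)) (U * P) = p • 1 ∧
      Matrix.fromCols (-(U * Q)) (U * P) * S₁ = p • 1 → C.IsL2Acyclic := by
    rintro p S₀ S₁ hp ⟨h₀, h₁, h₂⟩
    refine C.isL2Acyclic_of_homotopy hdim hp (S₀.submatrix e₀ e₁) (S₁.submatrix e₁ e₂) ?_ ?_ ?_
    · rw [hd₀, Matrix.submatrix_mul_equiv, h₀, submatrix_smul_one]
    · rw [hd₀, hd₁, Matrix.submatrix_mul_equiv, Matrix.submatrix_mul_equiv, ← submatrix_smul_one e₁,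
        ← h₁]
      rfl
    · rw [hd₁, Matrix.submatrix_mul_equiv, h₂, submatrix_smul_one]
  rcases hreg with h | h
  · exact key _ _ _ h (koszul_homotopy_left hPQ hUV)
  · exact key _ _ _ h (koszul_homotopy_right hPQ hUV)

end KoszulAcyclic

/-! ### Determinant class and torsion of Koszul complexes. -/

section KoszulComplex

open scoped ComplexOrder

variable {Λ : Type u} [CommGroup Λ] [TopologicalSpace Λ] [DiscreteTopology Λ]

/-- Elements of the group ring that act injectively on `ℓ²(Λ)` and whose Fourier transform is
almost everywhere nonzero with integrable logarithm. -/
structure IsLogIntegrable (p : MonoidAlgebra ℂ Λ) : Prop where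
  injective : Function.Injective (rightMul p)
  ae_ne_zero : ∀ᵐ χ ∂(dualMeasure Λ), evalChar χ p ≠ 0
  integrable : Integrable (fun χ => Real.log ‖evalChar χ p‖) (dualMeasure Λ)

/-- From above log δ is bounded because the dual is compact, from below by 2 log |p|. -/
lemma integrable_log_of_norm_sq_le {p : MonoidAlgebra ℂ Λ} (hp : IsLogIntegrable p)
    {δ : PontryaginDual Λ → ℝ} (hδ : Continuous δ)
    (hle : ∀ᵐ χ ∂(dualMeasure Λ), ‖evalChar χ p‖ ^ 2 ≤ δ χ) :
    Integrable (fun χ => Real.log (δ χ)) (dualMeasure Λ) := by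
  obtain ⟨B, hB⟩ := (isCompact_range hδ).bddAbove
  refine Integrable.mono' ((integrable_const |Real.log B|).add (hp.integrable.abs.const_mul 2))
    (Real.measurable_log.comp hδ.measurable).aestronglyMeasurable ?_
  filter_upwards [hp.ae_ne_zero, hle] with χ h0 h1
  have hpos : 0 < ‖evalChar χ p‖ ^ 2 := by positivity
  have h2 : Real.log (δ χ) ≤ Real.log B := Real.log_le_log (hpos.trans_le h1) (hB ⟨χ, rfl⟩)
  have h3 : 2 * Real.log ‖evalChar χ p‖ ≤ Real.log (δ χ) := by
    have := Real.log_le_log hpos h1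
    rwa [Real.log_pow, Nat.cast_ofNat] at this
  have h4 := neg_abs_le (Real.log ‖evalChar χ p‖)
  have h5 := le_abs_self (Real.log B)
  rw [Real.norm_eq_abs, abs_le]
  simp only [Pi.add_apply]
  constructor
  · linarith [abs_nonneg (Real.log B)]
  · linarith [abs_nonneg (Real.log ‖evalChar χ p‖)]

lemma fkDet_of_isEmpty {I : Type v} [Fintype I] [IsEmpty I]
    (A : FreeHilbert Λ I →L[ℂ] FreeHilbert Λ I) : fkDet A = 1 := by
  classical
  have hA : A = matrixOp ((0 : Matrix I I (MonoidAlgebra ℂ Λ)).conjTranspose * 0) :=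
    Subsingleton.elim _ _
  rw [hA, fkDet_matrixOp_conjTranspose_mul_self] <;> simp

variable {J : Type w} [Fintype J] [DecidableEq J] {P Q U V : Matrix J J (MonoidAlgebra ℂ Λ)}

open Classical in
/-- `L²`-invariants of a complex which, up to an automorphism in degree two with determinant of
absolute value one, is the Koszul complex of two commuting matrices over the group ring. -/
theorem BasedComplex.torsion_eq_one_of_koszul (C : BasedComplex.{u, v} Λ) (hdim : C.dim = 2)
    (e₀ : C.ι 0 ≃ J) (e₁ : C.ι 1 ≃ J ⊕ J) (e₂ : C.ι 2 ≃ J)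
    (hd₀ : C.d 0 = (Matrix.fromRows P Q).submatrix e₁ e₀)
    (hd₁ : C.d 1 = (Matrix.fromCols (-(U * Q)) (U * P)).submatrix e₂ e₁)
    (hPQ : Commute P Q) (hUV : U * V = 1) (hU : ∀ χ, ‖(evalMat χ U).det‖ = 1)
    (hreg : IsLogIntegrable P.det ∨ IsLogIntegrable Q.det) :
    C.IsL2Acyclic ∧ C.IsDetClass ∧ C.torsion = 1 := by
  have hac : C.IsL2Acyclic := C.isL2Acyclic_of_koszul hdim e₀ e₁ e₂ hd₀ hd₁ hPQ hUV
    (hreg.imp IsLogIntegrable.injective IsLogIntegrable.injective)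
  have hempty : ∀ n, IsEmpty (C.ι (n + 3)) := fun n => C.isEmpty _ (by omega)
  let p : PontryaginDual Λ → Matrix J J ℂ := fun χ => evalMat χ P
  let q : PontryaginDual Λ → Matrix J J ℂ := fun χ => evalMat χ Q
  let w : PontryaginDual Λ → Matrix J J ℂ := fun χ => evalMat χ U
  have hpq : ∀ χ, Commute (p χ) (q χ) := fun χ => by
    rw [Commute, SemiconjBy, ← evalMat_mul, ← evalMat_mul, hPQ.eq]
  have he₀ : ∀ χ, evalMat χ (C.d 0) = (Matrix.fromRows (p χ) (q χ)).submatrix e₁ e₀ := fun χ => by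
    rw [hd₀]
    ext i j
    rcases h : e₁ i with k | k <;> simp [evalMat, h, p, q]
  have he₁ : ∀ χ, evalMat χ (C.d 1) =
      (Matrix.fromCols (-(w χ * q χ)) (w χ * p χ)).submatrix e₂ e₁ := fun χ => by
    rw [hd₁]
    simp only [w, q, p, ← evalMat_mul, ← evalMat_neg]
    generalize -(U * Q) = A
    generalize U * P = B
    ext i j
    rcases h : e₁ j with k | k <;> simp [evalMat, h]
  let δ : PontryaginDual Λ → ℝ := fun χ =>
    ((Matrix.fromRows (p χ) (q χ)).conjTranspose * Matrix.fromRows (p χ) (q χ)).det.re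
  have hδ : ∀ χ, ((Matrix.fromRows (p χ) (q χ)).conjTranspose *
      Matrix.fromRows (p χ) (q χ)).det = (δ χ : ℂ) := fun χ => re_det_koszul_zero _ _
  have hΔ₀ : ∀ χ, (evalMat χ ((C.d 0).conjTranspose * C.d 0)).det = (δ χ : ℂ) := fun χ => by
    rw [evalMat_mul, evalMat_conjTranspose, he₀, Matrix.conjTranspose_submatrix,
      Matrix.submatrix_mul_equiv, Matrix.det_submatrix_equiv_self, hδ]
  have hδc : Continuous δ := by
    have h : δ = fun χ => (evalMat χ ((C.d 0).conjTranspose * C.d 0)).det.re := by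
      funext χ
      rw [hΔ₀, Complex.ofReal_re]
    rw [h]
    exact Complex.continuous_re.comp (continuous_evalMat _).matrix_det
  have hne : ∀ᵐ χ ∂(dualMeasure Λ), (p χ).det ≠ 0 ∨ (q χ).det ≠ 0 := by
    rcases hreg with h | h
    · filter_upwards [h.ae_ne_zero] with χ hχ
      exact Or.inl (by rwa [det_evalMat])
    · filter_upwards [h.ae_ne_zero] with χ hχ
      exact Or.inr (by rwa [det_evalMat])
  have hδpos : ∀ᵐ χ ∂(dualMeasure Λ), 0 < δ χ := by
    filter_upwards [hne] with χ hχ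
    rcases hχ with h | h
    · exact (by positivity : 0 < ‖(p χ).det‖ ^ 2).trans_le (norm_det_sq_le_re_det_koszul h)
    · exact (by positivity : 0 < ‖(q χ).det‖ ^ 2).trans_le (norm_det_sq_le_re_det_koszul' h)
  have hlog : Integrable (fun χ => Real.log (δ χ)) (dualMeasure Λ) := by
    rcases hreg with h | h
    · refine integrable_log_of_norm_sq_le h hδc ?_
      filter_upwards [h.ae_ne_zero] with χ hχ
      rw [← det_evalMat] at hχ ⊢
      exact norm_det_sq_le_re_det_koszul hχ
    · refine integrable_log_of_norm_sq_le h hδc ?_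
      filter_upwards [h.ae_ne_zero] with χ hχ
      rw [← det_evalMat] at hχ ⊢
      exact norm_det_sq_le_re_det_koszul' hχ
  -- All three Laplacians have pointwise determinant a power δ^m, with m = 1, 2, 1 in degrees 0, 1,
  -- 2, so one computation serves them all.
  have hfk : ∀ {I K : Type v} [Fintype I] [Fintype K] (N : Matrix K I (MonoidAlgebra ℂ Λ)) (m : ℕ),
      (∀ᵐ χ ∂(dualMeasure Λ), (evalMat χ (N.conjTranspose * N)).det = (δ χ : ℂ) ^ m) →
      fkDet (matrixOp (N.conjTranspose * N)) =
        Real.exp (∫ χ, Real.log (δ χ) ∂(dualMeasure Λ)) ^ m := fun N m h => by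
    have hre : (fun χ => (m : ℝ) * Real.log (δ χ)) =ᵐ[dualMeasure Λ]
        fun χ => Real.log (evalMat χ (N.conjTranspose * N)).det.re := by
      filter_upwards [h] with χ hχ
      rw [hχ, ← Complex.ofReal_pow, Complex.ofReal_re, Real.log_pow]
    rw [fkDet_matrixOp_conjTranspose_mul_self N ?_ ((hlog.const_mul _).congr hre),
      ← integral_congr_ae hre, integral_const_mul, Real.exp_nat_mul]
    filter_upwards [h, hδpos] with χ hχ h0
    rw [hχ]
    exact pow_ne_zero _ (by exact_mod_cast h0.ne')
  set E := Real.exp (∫ χ, Real.log (δ χ) ∂(dualMeasure Λ)) with hE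
  have hEpos : 0 < E := Real.exp_pos _
  have hD₀ : fkDet (C.laplacian 0) = E := by
    rw [C.laplacian_zero_eq, hfk _ 1, pow_one]
    exact Filter.Eventually.of_forall fun χ => by rw [hΔ₀, pow_one]
  have hgram : ∀ (χ : PontryaginDual Λ) (n : ℕ), evalMat χ ((Matrix.fromRows (C.d n).conjTranspose
      (C.d (n + 1))).conjTranspose * Matrix.fromRows (C.d n).conjTranspose (C.d (n + 1))) =
      evalMat χ (C.d n) * (evalMat χ (C.d n)).conjTranspose +
        (evalMat χ (C.d (n + 1))).conjTranspose * evalMat χ (C.d (n + 1)) := fun χ n => by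
    rw [Matrix.conjTranspose_fromRows_eq_fromCols_conjTranspose, Matrix.fromCols_mul_fromRows,
      Matrix.conjTranspose_conjTranspose, evalMat_add, evalMat_mul, evalMat_mul,
      evalMat_conjTranspose, evalMat_conjTranspose]
  have hD₁ : fkDet (C.laplacian 1) = E ^ 2 := by
    rw [C.laplacian_succ_eq, hfk _ 2]
    filter_upwards [hne] with χ hχ
    rw [hgram, he₀, he₁, Matrix.conjTranspose_submatrix, Matrix.conjTranspose_submatrix,
      Matrix.submatrix_mul_equiv, Matrix.submatrix_mul_equiv, ← hδ,
      ← det_koszul_one (hpq χ) (hU χ) hχ, ← Matrix.det_submatrix_equiv_self e₁]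
    rfl
  have hD₂ : fkDet (C.laplacian 2) = E := by
    rw [C.laplacian_succ_eq, hfk _ 1, pow_one]
    filter_upwards [hne] with χ hχ
    have := hempty 0
    have h0 : (evalMat χ (C.d 2)).conjTranspose * evalMat χ (C.d 2) = 0 := by
      ext i j
      simp [Matrix.mul_apply]
    rw [hgram, h0, add_zero, he₁, Matrix.conjTranspose_submatrix, Matrix.submatrix_mul_equiv,
      Matrix.det_submatrix_equiv_self, det_koszul_two (hpq χ) (hU χ) hχ, hδ, pow_one]
  have hdc : C.IsDetClass := fun n => by
    match n with
    | 0 => rw [hD₀]; exact hEpos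
    | 1 => rw [hD₁]; positivity
    | 2 => rw [hD₂]; exact hEpos
    | n + 3 =>
      have := hempty n
      rw [fkDet_of_isEmpty]
      exact one_pos
  refine ⟨hac, hdc, ?_⟩
  rw [torsion, if_pos ⟨hac, hdc⟩, hdim]
  -- The exponents (−1)^p p are 0, −1, 2, so the product is E⁰ · (E²)⁻¹ · E² = 1.
  simp only [Finset.prod_range_succ, Finset.prod_range_zero, hD₀, hD₁, hD₂]
  rw [Real.sqrt_eq_one]
  have : E ≠ 0 := hEpos.ne'
  norm_num
  field_simp

end KoszulComplex

/-! ### Determinants of twisted group ring elements. -/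

section TwistMatrix

variable {π : Type u} [Group π] {Λ : Type v} [CommGroup Λ] {V : Type*} [AddCommGroup V] [Module ℂ V]
  {J : Type w} [Fintype J] [DecidableEq J] (φ : π →* Λ) (ρ : π →* SpecialLinearGroup ℂ V)
  (b : Module.Basis J ℂ V)

/-- The matrix of the contragredient of `ρ(g)`. -/
def contragredientMatrix (g : π) : Matrix J J ℂ :=
  (LinearMap.toMatrix b b ((ρ g⁻¹ : V ≃ₗ[ℂ] V) : V →ₗ[ℂ] V)).transpose

lemma det_contragredientMatrix (g : π) : (contragredientMatrix ρ b g).det = 1 := by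
  rw [contragredientMatrix, Matrix.det_transpose, LinearMap.det_toMatrix]
  exact (ρ g⁻¹).det_eq_one

lemma contragredientMatrix_mul_inv (g : π) :
    contragredientMatrix ρ b g * contragredientMatrix ρ b g⁻¹ = 1 := by
  rw [contragredientMatrix, contragredientMatrix, ← Matrix.transpose_mul,
    ← LinearMap.toMatrix_comp, inv_inv]
  have h : ((ρ g : V ≃ₗ[ℂ] V) : V →ₗ[ℂ] V) ∘ₗ ((ρ g⁻¹ : V ≃ₗ[ℂ] V) : V →ₗ[ℂ] V) =
      LinearMap.id := by
    have h1 : ρ g * ρ g⁻¹ = 1 := by rw [← map_mul, mul_inv_cancel, map_one]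
    ext v
    exact congrArg (fun u : SpecialLinearGroup ℂ V => u.1 v) h1
  rw [h, LinearMap.toMatrix_id, Matrix.transpose_one]

lemma twistHom_eq_smul (g : π) :
    twistHom φ ρ b g = MonoidAlgebra.single (φ g) (1 : ℂ) •
      (contragredientMatrix ρ b g).map (algebraMap ℂ (MonoidAlgebra ℂ Λ)) := by
  ext j i : 2
  simp [twistHom, contragredientMatrix, MonoidAlgebra.single_mul_single]

/-- The matrix over `ℂΛ` of the twisted action of an element of `ℂπ`. -/
abbrev twistRep : MonoidAlgebra ℂ π →ₐ[ℂ] Matrix J J (MonoidAlgebra ℂ Λ) :=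
  MonoidAlgebra.lift ℂ _ π (twistHom φ ρ b)

lemma isUnit_det_twistRep_single (g : π) {c : ℂ} (hc : c ≠ 0) :
    IsUnit (twistRep φ ρ b (MonoidAlgebra.single g c)).det := by
  refine Matrix.isUnit_det_of_right_inverse
    (B := twistRep φ ρ b (MonoidAlgebra.single g⁻¹ c⁻¹)) ?_
  rw [← map_mul, MonoidAlgebra.single_mul_single, mul_inv_cancel, mul_inv_cancel₀ hc,
    ← MonoidAlgebra.one_def, map_one]

/-- With N the contragredient matrix of g and M its inverse, φ(g)N − 1 = N(φ(g) − M), and det N = 1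
because ρ has values in SL(V). -/
lemma det_twistRep_single_sub_one (g : π) :
    (twistRep φ ρ b (MonoidAlgebra.single g 1 - 1)).det =
      Polynomial.aeval (MonoidAlgebra.single (φ g) (1 : ℂ))
        (contragredientMatrix ρ b g⁻¹).charpoly := by
  set N := (contragredientMatrix ρ b g).map (algebraMap ℂ (MonoidAlgebra ℂ Λ)) with hN
  set M := (contragredientMatrix ρ b g⁻¹).map (algebraMap ℂ (MonoidAlgebra ℂ Λ)) with hM
  have hNM : N * M = 1 := by
    rw [hN, hM, ← Matrix.map_mul, contragredientMatrix_mul_inv,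
      Matrix.map_one _ (map_zero _) (map_one _)]
  have hdet : N.det = 1 := by
    rw [hN, ← RingHom.mapMatrix_apply, ← RingHom.map_det, det_contragredientMatrix, map_one]
  have h : twistRep φ ρ b (MonoidAlgebra.single g 1 - 1) =
      N * (Matrix.scalar J (MonoidAlgebra.single (φ g) (1 : ℂ)) - M) := by
    rw [map_sub, map_one, MonoidAlgebra.lift_single, one_smul, twistHom_eq_smul, mul_sub, hNM,
      ← hN]
    congr 1
    ext j i : 2
    simp [mul_comm]
  rw [h, Matrix.det_mul, hdet, one_mul, ← Matrix.eval_charpoly, hM, Matrix.charpoly_map,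
    Polynomial.eval_map_algebraMap]

variable [TopologicalSpace Λ]

/-- Here the determinant-one condition on ρ makes changes of lifts and orientations invisible to the
torsion. -/
lemma norm_det_evalMat_twistRep_single (χ : PontryaginDual Λ) (g : π) {c : ℂ} (hc : ‖c‖ = 1) :
    ‖(evalMat χ (twistRep φ ρ b (MonoidAlgebra.single g c))).det‖ = 1 := by
  have h : evalMat χ (twistRep φ ρ b (MonoidAlgebra.single g c)) =
      (c * (χ (φ g) : ℂ)) • contragredientMatrix ρ b g := by
    rw [MonoidAlgebra.lift_single, twistHom_eq_smul]
    ext j i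
    simp [evalMat, evalChar_single, mul_comm]
    ring
  rw [h, Matrix.det_smul, det_contragredientMatrix]
  simp [hc, Circle.norm_coe]

variable [DiscreteTopology Λ]

lemma isLogIntegrable_det_twistRep (g h : π) {c : ℂ} (hc : ‖c‖ = 1) (hg : ¬ IsOfFinOrder (φ g)) :
    IsLogIntegrable
      (twistRep φ ρ b (MonoidAlgebra.single h c * (MonoidAlgebra.single g 1 - 1))).det := by
  have hc0 : c ≠ 0 := by
    rintro rfl
    simp at hc
  have hdet : (twistRep φ ρ b (MonoidAlgebra.single h c * (MonoidAlgebra.single g 1 - 1))).det =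
      (twistRep φ ρ b (MonoidAlgebra.single h c)).det *
        Polynomial.aeval (MonoidAlgebra.single (φ g) (1 : ℂ))
          (contragredientMatrix ρ b g⁻¹).charpoly := by
    rw [map_mul, Matrix.det_mul, det_twistRep_single_sub_one]
  have hmonic := Matrix.charpoly_monic (contragredientMatrix ρ b g⁻¹)
  have heval : ∀ χ : PontryaginDual Λ, ‖evalChar χ
      (twistRep φ ρ b (MonoidAlgebra.single h c * (MonoidAlgebra.single g 1 - 1))).det‖ =
      ‖(contragredientMatrix ρ b g⁻¹).charpoly.eval (χ (φ g) : ℂ)‖ := fun χ => by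
    rw [hdet, map_mul, norm_mul, ← det_evalMat, norm_det_evalMat_twistRep_single φ ρ b χ h hc,
      one_mul, ← Polynomial.aeval_algHom_apply, evalChar_single, one_mul]
    simp
  refine ⟨?_, ?_, ?_⟩
  · rw [hdet]
    exact rightMul_injective_mul
      (rightMul_injective_of_isUnit (isUnit_det_twistRep_single φ ρ b h hc0))
      (rightMul_injective_aeval hg hmonic)
  · filter_upwards [ae_eval_dual_ne_zero hg hmonic.ne_zero] with χ hχ
    rw [← norm_ne_zero_iff, heval]
    exact norm_ne_zero_iff.2 hχ
  · simp only [heval]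
    exact integrable_log_norm_eval_dual hg _

end TwistMatrix

/-! ### The torus complex as a Koszul complex. -/

section Torus

/-- The `0`-cell of the torus. -/
def vertexCell : TorusCell 0 := ⟨∅, rfl⟩

/-- The `1`-cell of the torus in direction `i`. -/
def edgeCell (i : Fin 2) : TorusCell 1 := ⟨{i}, Finset.card_singleton i⟩

/-- The `2`-cell of the torus. -/
def faceCell : TorusCell 2 := ⟨Finset.univ, rfl⟩

/-- The translation by one in direction `i`. -/
def unitShift (i : Fin 2) : ZTwo := Multiplicative.ofAdd (Pi.single i 1)

/-- The `0`-chains in the standard basis. -/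
def vertexEquiv (J : Type*) : TorusCell 0 × J ≃ J where
  toFun x := x.2
  invFun j := (vertexCell, j)
  left_inv x := Prod.ext (Subtype.ext (Finset.card_eq_zero.1 x.1.2).symm) rfl
  right_inv _ := rfl

/-- The `1`-chains in the standard basis. -/
def edgeEquiv (J : Type*) : TorusCell 1 × J ≃ J ⊕ J where
  toFun x := if 0 ∈ x.1.1 then Sum.inl x.2 else Sum.inr x.2
  invFun := Sum.elim (fun j => (edgeCell 0, j)) fun j => (edgeCell 1, j)
  left_inv x := by
    obtain ⟨S, j⟩ := x
    have h : ∀ S : TorusCell 1, S = edgeCell 0 ∨ S = edgeCell 1 := by decide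
    rcases h S with rfl | rfl <;> simp [edgeCell]
  right_inv x := by
    rcases x with j | j <;> simp [edgeCell]

/-- The `2`-chains in the standard basis. -/
def faceEquiv (J : Type*) : TorusCell 2 × J ≃ J where
  toFun x := x.2
  invFun j := (faceCell, j)
  left_inv x := Prod.ext (Subtype.ext
    ((Finset.card_eq_iff_eq_univ x.1.1).1 (by simpa using x.1.2)).symm) rfl
  right_inv _ := rfl

variable (L : CellLifts)

lemma single_mul_single_sub_one {G : Type*} [Group G] (g h : G) (c : ℂ) :
    MonoidAlgebra.single g c * (MonoidAlgebra.single h 1 - 1) =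
      MonoidAlgebra.single (g * h) c - MonoidAlgebra.single g c := by
  rw [mul_sub, mul_one, MonoidAlgebra.single_mul_single, mul_one]

lemma boundaryMatrix_edgeCell (i : Fin 2) :
    L.boundaryMatrix 0 (edgeCell i) vertexCell =
      MonoidAlgebra.single (Multiplicative.ofAdd (L.corner (edgeCell i) - L.corner vertexCell))
        (((L.sign (edgeCell i) : ℤ) * (L.sign vertexCell : ℤ) : ℤ) : ℂ) *
      (MonoidAlgebra.single (unitShift i) 1 - 1) := by
  have hu : (Finset.univ : Finset (edgeCell i).1) = {⟨i, Finset.mem_singleton_self i⟩} := by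
    decide +revert
  have hf : (edgeCell i).face ⟨i, Finset.mem_singleton_self i⟩ = vertexCell := by
    decide +revert
  have hc : ((edgeCell i).1.filter (· < i)).card = 0 := by
    decide +revert
  rw [CellLifts.boundaryMatrix_apply, hu, Finset.sum_singleton, if_pos hf, hc, pow_zero, mul_one,
    single_mul_single_sub_one, unitShift, ← ofAdd_add, sub_add_eq_add_sub]

lemma boundaryMatrix_faceCell_zero :
    L.boundaryMatrix 1 faceCell (edgeCell 0) =
      -(MonoidAlgebra.single (Multiplicative.ofAdd (L.corner faceCell - L.corner (edgeCell 0)))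
        (((L.sign faceCell : ℤ) * (L.sign (edgeCell 0) : ℤ) : ℤ) : ℂ) *
      (MonoidAlgebra.single (unitShift 1) 1 - 1)) := by
  have hu : (Finset.univ : Finset faceCell.1) = {⟨0, by decide⟩, ⟨1, by decide⟩} := by decide
  have hc : (faceCell.1.filter (· < 1)).card = 1 := by decide
  rw [CellLifts.boundaryMatrix_apply, hu, Finset.sum_pair (by decide), if_neg (by decide),
    if_pos (by decide), zero_add, hc, pow_one, mul_neg_one, Int.cast_neg, MonoidAlgebra.single_neg,
    MonoidAlgebra.single_neg, single_mul_single_sub_one, unitShift, ← ofAdd_add,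
    sub_add_eq_add_sub, neg_sub_neg, neg_sub]

lemma boundaryMatrix_faceCell_one :
    L.boundaryMatrix 1 faceCell (edgeCell 1) =
      MonoidAlgebra.single (Multiplicative.ofAdd (L.corner faceCell - L.corner (edgeCell 1)))
        (((L.sign faceCell : ℤ) * (L.sign (edgeCell 1) : ℤ) : ℤ) : ℂ) *
      (MonoidAlgebra.single (unitShift 0) 1 - 1) := by
  have hu : (Finset.univ : Finset faceCell.1) = {⟨0, by decide⟩, ⟨1, by decide⟩} := by decide
  have hc : (faceCell.1.filter (· < 0)).card = 0 := by decide
  rw [CellLifts.boundaryMatrix_apply, hu, Finset.sum_pair (by decide), if_pos (by decide),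
    if_neg (by decide), add_zero, hc, pow_zero, mul_one, single_mul_single_sub_one, unitShift,
    ← ofAdd_add, sub_add_eq_add_sub]

/-- The factor by which the boundary of the `2`-cell differs from the Koszul differential. -/
def koszulFactor : MonoidAlgebra ℂ ZTwo :=
  MonoidAlgebra.single (Multiplicative.ofAdd (L.corner faceCell - L.corner (edgeCell 0) -
      L.corner (edgeCell 1) + L.corner vertexCell))
    (((L.sign faceCell : ℤ) * (L.sign (edgeCell 0) : ℤ) * (L.sign (edgeCell 1) : ℤ) *
      (L.sign vertexCell : ℤ) : ℤ) : ℂ)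

/-- The corners and signs of `koszulFactor` are symmetric in the two edges: multiplying by the
coefficient of edge i cancels that edge and the vertex and leaves the coefficient of the other edge
in the boundary of the 2-cell. -/
lemma koszulFactor_mul_single (i j : Fin 2) (hij : i ≠ j) :
    koszulFactor L * MonoidAlgebra.single
        (Multiplicative.ofAdd (L.corner (edgeCell i) - L.corner vertexCell))
        (((L.sign (edgeCell i) : ℤ) * (L.sign vertexCell : ℤ) : ℤ) : ℂ) =
      MonoidAlgebra.single (Multiplicative.ofAdd (L.corner faceCell - L.corner (edgeCell j)))
        (((L.sign faceCell : ℤ) * (L.sign (edgeCell j) : ℤ) : ℤ) : ℂ) := by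
  have hs : ∀ x : ℤˣ, (x : ℤ) * x = 1 := Int.units_coe_mul_self
  have hv := hs (L.sign vertexCell)
  have h0 := hs (L.sign (edgeCell 0))
  have h1 := hs (L.sign (edgeCell 1))
  rw [koszulFactor, MonoidAlgebra.single_mul_single, ← ofAdd_add, ← Int.cast_mul]
  have hcases : (i = 0 ∧ j = 1) ∨ (i = 1 ∧ j = 0) := by omega
  rcases hcases with ⟨rfl, rfl⟩ | ⟨rfl, rfl⟩
  · congr 2
    · abel
    · linear_combination (L.sign faceCell : ℤ) * (L.sign (edgeCell 1) : ℤ) *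
        ((L.sign vertexCell : ℤ) * (L.sign vertexCell : ℤ) * h0 + hv)
  · congr 2
    · abel
    · linear_combination (L.sign faceCell : ℤ) * (L.sign (edgeCell 0) : ℤ) *
        ((L.sign vertexCell : ℤ) * (L.sign vertexCell : ℤ) * h1 + hv)

lemma boundaryMatrix_faceCell_zero_eq :
    L.boundaryMatrix 1 faceCell (edgeCell 0) =
      -(koszulFactor L * L.boundaryMatrix 0 (edgeCell 1) vertexCell) := by
  rw [boundaryMatrix_faceCell_zero, boundaryMatrix_edgeCell, ← mul_assoc,
    koszulFactor_mul_single L 1 0 (by decide)]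

lemma boundaryMatrix_faceCell_one_eq :
    L.boundaryMatrix 1 faceCell (edgeCell 1) =
      koszulFactor L * L.boundaryMatrix 0 (edgeCell 0) vertexCell := by
  rw [boundaryMatrix_faceCell_one, boundaryMatrix_edgeCell, ← mul_assoc,
    koszulFactor_mul_single L 0 1 (by decide)]

lemma norm_cast_units_int (x : ℤˣ) : ‖((x : ℤ) : ℂ)‖ = 1 := by
  rcases Int.units_eq_one_or x with rfl | rfl <;> simp

/-- If `ℤ²` maps onto an infinite group, one of the two generators has infinite order. -/
lemma exists_unitShift_not_isOfFinOrder {Λ : Type*} [CommGroup Λ] [Infinite Λ] (φ : ZTwo →* Λ)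
    (hφ : Function.Surjective φ) :
    ¬ IsOfFinOrder (φ (unitShift 0)) ∨ ¬ IsOfFinOrder (φ (unitShift 1)) := by
  by_contra h
  push Not at h
  have h0 := finite_zpowers.2 h.1
  have h1 := finite_zpowers.2 h.2
  have : (Set.univ : Set Λ).Finite := by
    -- If both generators had finite images, Λ would be a product of two finite cyclic subgroups.
    refine (h0.mul h1).subset fun y _ => ?_
    obtain ⟨v, rfl⟩ := hφ y
    refine Set.mem_mul.2 ⟨φ (unitShift 0) ^ (v.toAdd 0), ⟨_, rfl⟩,
      φ (unitShift 1) ^ (v.toAdd 1), ⟨_, rfl⟩, ?_⟩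
    rw [← map_zpow, ← map_zpow, ← map_mul]
    congr 1
    apply Multiplicative.toAdd.injective
    funext k
    fin_cases k <;> simp [unitShift]
  exact Set.infinite_univ this

variable {V : Type*} [AddCommGroup V] [Module ℂ V] (ρ : ZTwo →* SpecialLinearGroup ℂ V)
  {Λ : Type u} [CommGroup Λ] [Infinite Λ] (φ : ZTwo →* Λ)
  {J : Type w} [Fintype J] [DecidableEq J] (b : Module.Basis J ℂ V)

theorem torusComplex_twist_torsion (hφ : Function.Surjective φ) :
    ((torusComplex L).twist φ ρ b).IsL2Acyclic ∧
      ((torusComplex L).twist φ ρ b).IsDetClass ∧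
      ((torusComplex L).twist φ ρ b).torsion = 1 := by
  -- The discrete topology makes the Pontryagin dual the compact group of all characters of Λ.
  let _ : TopologicalSpace Λ := ⊥
  have : DiscreteTopology Λ := ⟨rfl⟩
  let T := twistRep φ ρ b
  let a : Fin 2 → MonoidAlgebra ℂ ZTwo := fun i => L.boundaryMatrix 0 (edgeCell i) vertexCell
  have hsign : ∀ {p q : ℕ} (S : TorusCell p) (S' : TorusCell q),
      ‖(((L.sign S : ℤ) * (L.sign S' : ℤ) : ℤ) : ℂ)‖ = 1 := fun S S' => by
    rw [Int.cast_mul, norm_mul, norm_cast_units_int, norm_cast_units_int, one_mul]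
  have hfac : ‖(((L.sign faceCell : ℤ) * (L.sign (edgeCell 0) : ℤ) * (L.sign (edgeCell 1) : ℤ) *
      (L.sign vertexCell : ℤ) : ℤ) : ℂ)‖ = 1 := by
    simp only [Int.cast_mul, norm_mul, norm_cast_units_int, one_mul]
  have hunit : IsUnit (T (koszulFactor L)) :=
    (Matrix.isUnit_iff_isUnit_det _).2 (isUnit_det_twistRep_single φ ρ b _ fun h => by
      rw [h, norm_zero] at hfac
      exact zero_ne_one hfac)
  obtain ⟨V', hV'⟩ := hunit.exists_right_inv
  refine BasedComplex.torsion_eq_one_of_koszul ((torusComplex L).twist φ ρ b) rfl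
    (P := T (a 0)) (Q := T (a 1)) (U := T (koszulFactor L)) (V := V')
    (vertexEquiv J) (edgeEquiv J) (faceEquiv J) ?_ ?_ ?_ hV'
    (fun χ => norm_det_evalMat_twistRep_single φ ρ b χ _ hfac) ?_
  · refine Matrix.ext fun x y => ?_
    obtain ⟨s, rfl⟩ := (edgeEquiv J).symm.surjective x
    obtain ⟨t, rfl⟩ := (vertexEquiv J).symm.surjective y
    rcases s with j | j <;> rfl
  · have hQ : -(T (koszulFactor L) * T (a 1)) = T (L.boundaryMatrix 1 faceCell (edgeCell 0)) := by
      rw [boundaryMatrix_faceCell_zero_eq, map_neg, map_mul]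
    have hP : T (koszulFactor L) * T (a 0) = T (L.boundaryMatrix 1 faceCell (edgeCell 1)) := by
      rw [boundaryMatrix_faceCell_one_eq, map_mul]
    rw [hQ, hP]
    refine Matrix.ext fun x y => ?_
    obtain ⟨s, rfl⟩ := (faceEquiv J).symm.surjective x
    obtain ⟨t, rfl⟩ := (edgeEquiv J).symm.surjective y
    rcases t with j | j <;> rfl
  · exact (Commute.all (a 0) (a 1)).map T
  · refine (exists_unitShift_not_isOfFinOrder φ hφ).imp (fun h => ?_) fun h => ?_
    all_goals
      simp only [a, boundaryMatrix_edgeCell]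
      exact isLogIntegrable_det_twistRep φ ρ b _ _ (hsign _ _) h

end Torus

end L2Torsion

end

open L2Torsion in
theorem mainTheorem9
    {V : Type*} [AddCommGroup V] [Module ℂ V] [FiniteDimensional ℂ V]
    (ρ : ZTwo →* SpecialLinearGroup ℂ V)
    {Λ : Type*} [Group Λ] [Infinite Λ] (φ : ZTwo →* Λ) (hφ : Function.Surjective φ)
    {J : Type*} [Fintype J] [DecidableEq J] (b : Module.Basis J ℂ V) (L : CellLifts) :
    ((torusComplex L).twist φ ρ b).IsL2Acyclic ∧
      ((torusComplex L).twist φ ρ b).IsDetClass ∧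
      ((torusComplex L).twist φ ρ b).torsion = 1 := by
  -- Commutativity passes from ℤ² to its image; extending the given group structure keeps the
  -- complex in the statement the same.
  let _ : CommGroup Λ := { ‹Group Λ› with
    mul_comm := fun x y => by
      obtain ⟨a, rfl⟩ := hφ x
      obtain ⟨c, rfl⟩ := hφ y
      rw [← map_mul, mul_comm, map_mul] }
  exact torusComplex_twist_torsion L ρ φ b hφ
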